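/- Let $p$ be a prime, $W=W(\overline{\mathbb F}_p)$ the Witt ring of $\overline{\mathbb F}_p$ and $K=\operatorname{Frac} W$. Let $s\ge 1$ and $\underline a=(a_1,\dots,a_s)\in\mathbb Z_p^s$ with $a_i\notin\mathbb Z_{\le 0}$ for all $i$. For $a\in\mathbb Z_p$ let $a'=(a+l)/p$, where $l\in\{0,\dots,p-1\}$ is the integer with $a+l\equiv 0 \bmod p$, and put $\underline a'=(a_1',\dots,a_s')$. With $(a)_n=a(a+1)\cdots(a+n-1)$ let $$F_{\underline a}(t)=\sum_{n\ge 0}\frac{(a_1)_n}{n!}\cdots\frac{(a_s)_n}{n!}\,t^n .$$ Let $\log$ be the Iwasawa logarithm ($\log p=0$), and for $z\in\mathbb Z_p$ let $$\gamma_p=-\lim_{r\to\infty}\frac1{p^r}\sum_{0\le j<p^r,\ p\nmid j}\log j,\qquad \psi_p(z)=-\gamma_p+\lim_{n\in\mathbb Z_{>0},\,n\to z}\ \sum_{1\le k<n,\ p\nmid k}\frac1k .$$ For $c\in 1+pW$ let $\sigma$ be the Frobenius on $W[[t]]$ with $\sigma(t)=ct^p$ that acts on $W$ as the Witt vector Frobenius,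 and put $$G_{\underline a}(t)=\sum_{i=1}^s\psi_p(a_i)+s\gamma_p-p^{-1}\log c+\int_0^t\bigl(F_{\underline a}(t)-F_{\underline a'}(t^\sigma)\bigr)\frac{dt}{t},$$ where $F_{\underline a'}(t^\sigma)=\sigma(F_{\underline a'}(t))$ and $\int_0^t(-)\frac{dt}t$ sends $\sum_{n\ge1}u_nt^n$ to $\sum_{n\ge 1}\frac{u_n}{n}t^n$. Let $\mathcal F^{(\sigma)}_{\underline a}(t)=G_{\underline a}(t)/F_{\underline a}(t)$, and for a power series $f(t)=\sum u_nt^n$ write $f(t)_{<m}=\sum_{n<m}u_nt^n$. If $c\in 1+2pW$, then for all $n\ge 1$ the power series $\mathcal F^{(\sigma)}_{\underline a}(t)$ and $G_{\underline a}(t)_{<p^n}/F_{\underline a}(t)_{<p^n}$ have coefficients in $W$ and $$\mathcal F^{(\sigma)}_{\underline a}(t)\equiv\frac{G_{\underline a}(t)_{<p^n}}{F_{\underline a}(t)_{<p^n}}\mod p^nW[[t]].$$ If $p=2$ and $c\in 1+2W$, then for all $n\ge1$ both series have coefficients in $W$ and the congruence holds modulo $p^{n-1}W[[t]]$. -/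

import Mathlib

open Filter Topology PowerSeries

noncomputable section

namespace PadicHG

/-- The Witt ring `W = W(𝔽̄_p)`. -/
abbrev W (p : ℕ) [Fact p.Prime] : Type := WittVector p (AlgebraicClosure (ZMod p))

/-- The fraction field `K = Frac W`. -/
abbrev K (p : ℕ) [Fact p.Prime] : Type := FractionRing (W p)

/-- The canonical embedding `ℤ_p = W(𝔽_p) → W = W(𝔽̄_p)`. -/
def padicIntToW (p : ℕ) [Fact p.Prime] : ℤ_[p] →+* W p :=
  (WittVector.map (algebraMap (ZMod p) (AlgebraicClosure (ZMod p)))).comp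
    (WittVector.equiv p).symm.toRingHom

/-- The canonical embedding `ℤ_p → W → K`. -/
def padicIntToK (p : ℕ) [Fact p.Prime] : ℤ_[p] →+* K p :=
  (algebraMap (W p) (K p)).comp (padicIntToW p)

/-- `y` is the limit of the family `x` along the filter `l` for the `p`-adic topology of `K`
(a basis of neighbourhoods of `0` is given by the subgroups `p ^ m W`). -/
def IsPadicLim (p : ℕ) [Fact p.Prime] {ι : Type*} (l : Filter ι) (x : ι → K p) (y : K p) : Prop :=
  ∀ m : ℕ, ∀ᶠ i in l, ∃ w : W p, x i - y = (p : K p) ^ m * algebraMap (W p) (K p) w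

open Classical in
/-- The `p`-adic limit of `x` along `l` (`0` if there is none). -/
def padicLim (p : ℕ) [Fact p.Prime] {ι : Type*} (l : Filter ι) (x : ι → K p) : K p :=
  if h : ∃ y, IsPadicLim p l x y then h.choose else 0

/-! ### The Iwasawa logarithm on `K` -/

/-- The subset `1 + p W` of `K`, that is, the set of all `z ∈ K` with `|z - 1|_p < 1`. -/
def IsOneUnit (p : ℕ) [Fact p.Prime] (z : K p) : Prop :=
  ∃ e : W p, z = 1 + (p : K p) * algebraMap (W p) (K p) e

/-- The logarithmic series `- ∑_{n ≥ 1} (1 - z) ^ n / n`, for `z ∈ 1 + p W`. -/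
def logSeries (p : ℕ) [Fact p.Prime] (z : K p) : K p :=
  padicLim p atTop (fun N : ℕ => -∑ n ∈ Finset.Icc 1 N, (1 - z) ^ n / (n : K p))

open Classical in
/-- The Iwasawa logarithm on `K`: the continuous homomorphism `Kˣ → K` with `log p = 0` that is
given by the logarithmic series on `1 + p W`. Every `z ∈ Kˣ` has a power `z ^ N`, `N ≥ 1`, such
that `z ^ N * p ^ m ∈ 1 + p W` for some `m ∈ ℤ`, and then `log z = log (z ^ N * p ^ m) / N`.
The value does not depend on `N`; we take the least one. -/
def iwasawaLog (p : ℕ) [Fact p.Prime] (z : K p) : K p :=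
  if h : ∃ N : ℕ, 0 < N ∧ ∃ m : ℤ, IsOneUnit p (z ^ N * (p : K p) ^ m) then
    logSeries p (z ^ Nat.find h * (p : K p) ^ (Nat.find_spec h).2.choose) / (Nat.find h : K p)
  else 0

/-! ### The `p`-adic digamma function -/

/-- `ψ̃_p(z) = lim_{n → z, n > 0} ∑_{1 ≤ k < n, p ∤ k} 1 / k` for `z ∈ ℤ_p`. -/
def psiTilde (p : ℕ) [Fact p.Prime] (z : ℤ_[p]) : K p :=
  padicLim p (comap (fun n : ℕ => (n : ℤ_[p])) (𝓝 z) ⊓ 𝓟 {n : ℕ | 0 < n})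
    (fun n : ℕ => ∑ k ∈ (Finset.Ico 1 n).filter (fun k => ¬ p ∣ k), (1 : K p) / (k : K p))

/-- The `p`-adic Euler constant
`γ_p = - lim_{s → ∞} p ^ (-s) ∑_{0 ≤ j < p ^ s, p ∤ j} log j`. -/
def eulerGamma (p : ℕ) [Fact p.Prime] : K p :=
  -padicLim p atTop (fun s : ℕ =>
    (1 / (p : K p) ^ s) *
      ∑ j ∈ (Finset.range (p ^ s)).filter (fun j => ¬ p ∣ j), iwasawaLog p (j : K p))

/-- The `p`-adic digamma function `ψ_p(z) = - γ_p + ψ̃_p(z)` on `ℤ_p`. -/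
def digamma (p : ℕ) [Fact p.Prime] (z : ℤ_[p]) : K p :=
  -eulerGamma p + psiTilde p z

/-! ### Dwork primes -/

theorem exists_dworkPrime (p : ℕ) [Fact p.Prime] (a : ℤ_[p]) :
    ∃ b : ℤ_[p], ∃ l : ℕ, l < p ∧ (p : ℤ_[p]) * b = a + (l : ℤ_[p]) := by
  have h := PadicInt.sub_zmodRepr_mem (-a)
  rw [PadicInt.maximalIdeal_eq_span_p, Ideal.mem_span_singleton] at h
  obtain ⟨b, hb⟩ := h
  refine ⟨-b, PadicInt.zmodRepr (-a), PadicInt.zmodRepr_lt_p _, ?_⟩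
  linear_combination hb

/-- The Dwork prime `a' = (a + l) / p`, where `l ∈ {0, …, p - 1}` and `a + l ≡ 0` mod `p`. -/
def dworkPrime (p : ℕ) [Fact p.Prime] (a : ℤ_[p]) : ℤ_[p] :=
  (exists_dworkPrime p a).choose

/-! ### The power series -/

/-- The hypergeometric series
`F_a(t) = ₛF_{s-1}(a_1, …, a_s; 1, …, 1; t) = ∑ₙ ((a_1)_n / n!) ⋯ ((a_s)_n / n!) tⁿ`. -/
def hypF (p : ℕ) [Fact p.Prime] {s : ℕ} (a : Fin s → ℤ_[p]) : (K p)⟦X⟧ :=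
  PowerSeries.mk fun n =>
    ∏ i, (ascPochhammer (K p) n).eval (padicIntToK p (a i)) / (n.factorial : K p)

/-- The `p`-th Frobenius `σ` with `σ(t) = c t ^ p`, compatible with the Frobenius `φ` of `W`:
`σ(∑ f_n tⁿ) = ∑ φ(f_n) cⁿ t ^ (p n)`. -/
def sigma (p : ℕ) [Fact p.Prime] (c : W p) (f : (K p)⟦X⟧) : (K p)⟦X⟧ :=
  PowerSeries.mk fun n =>
    if p ∣ n then
      WittVector.FractionRing.frobenius p (AlgebraicClosure (ZMod p))
        (PowerSeries.coeff (n / p) f) * algebraMap (W p) (K p) c ^ (n / p)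
    else 0

/-- The operator `∫₀ᵗ (-) dt / t`, which sends `∑_{n ≥ 1} f_n tⁿ` to `∑_{n ≥ 1} (f_n / n) tⁿ`. -/
def intLog (p : ℕ) [Fact p.Prime] (f : (K p)⟦X⟧) : (K p)⟦X⟧ :=
  PowerSeries.mk fun n => if n = 0 then 0 else PowerSeries.coeff n f / (n : K p)

/-- `G_a(t) = ψ_p(a_1) + ⋯ + ψ_p(a_s) + s γ_p - p⁻¹ log c + ∫₀ᵗ (F_a(t) - F_{a'}(t ^ σ)) dt / t`. -/
def hypG (p : ℕ) [Fact p.Prime] {s : ℕ} (a : Fin s → ℤ_[p]) (c : W p) : (K p)⟦X⟧ :=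
  PowerSeries.C (∑ i, digamma p (a i) + (s : K p) * eulerGamma p
      - (p : K p)⁻¹ * iwasawaLog p (algebraMap (W p) (K p) c))
    + intLog p (hypF p a - sigma p c (hypF p (fun i => dworkPrime p (a i))))

/-- The `p`-adic hypergeometric function of logarithmic type `G_a(t) / F_a(t)`
(the constant term of `F_a(t)` is `1`). -/
def hypLog (p : ℕ) [Fact p.Prime] {s : ℕ} (a : Fin s → ℤ_[p]) (c : W p) : (K p)⟦X⟧ :=
  hypG p a c * (hypF p a)⁻¹

/-- The truncation `f(t)_{< m}`, viewed as a power series. -/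
def truncLT (p : ℕ) [Fact p.Prime] (m : ℕ) (f : (K p)⟦X⟧) : (K p)⟦X⟧ :=
  ((PowerSeries.trunc m f : Polynomial (K p)) : (K p)⟦X⟧)

/-- `f ≡ g mod p ^ N W[[t]]`: both series have coefficients in `W`, and their difference lies
in `p ^ N W[[t]]`. -/
def CongrMod (p : ℕ) [Fact p.Prime] (N : ℕ) (f g : (K p)⟦X⟧) : Prop :=
  ∃ f₀ g₀ : (W p)⟦X⟧, PowerSeries.map (algebraMap (W p) (K p)) f₀ = f ∧
    PowerSeries.map (algebraMap (W p) (K p)) g₀ = g ∧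
    ∃ h : (W p)⟦X⟧, f₀ - g₀ = (p : (W p)⟦X⟧) ^ N * h

end PadicHG

end

noncomputable section

namespace PadicHG

/-! ### Truncation congruences for towers of sequences -/

section Tower

variable {R : Type*} [CommRing R]

/-! Write `A_k = ∏ (a_i)_k / k!` for the coefficients of `F_a`; they lie in `ℤ_p`, being products of
values of `Ring.multichoose`. The coefficients of `G_a` turn out to be `A_k q_k` with `q_k ∈ W`, and
everything rests on how `q_k` varies with `k` modulo powers of `p`.

Dwork's congruence (`dvd_mul_cutoff_sub_of_isDworkTower`) says that if `k ≡ k'` mod `p ^ e` always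
forces `q_k ≡ q_k'` mod `p ^ e`, then `∑ A_k q_k t ^ k / ∑ A_k t ^ k` agrees modulo `p ^ n` with the
quotient of the truncations below `p ^ n`. It needs only that `A_k` is the product of a factor with
the same property and the coefficient of index `⌊k / p⌋` for `a'`, and so on up the tower of Dwork
primes. The factor comes from sorting `a (a + 1) ⋯ (a + k - 1)` into units and multiples of `p`.

For `p ∤ k` one has `q_k = 1 / k`. For `k = p m` the factor is a unit `u_k`, and `q_k = u_k⁻¹ (u_k -
c ^ m) / (p m)`. Writing `u_{pm} = 1 + p m D(m)` and `c ^ m = 1 + p m Γ(m)` gives `q_k = u_k⁻¹ (D(m)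
- Γ(m))`, which still makes sense at `m = 0`. There `D(0) = ∑ (ψ_p(a_i) + γ_p)` and `Γ(0) = p⁻¹ log
c`, so the constant term of `G_a` is exactly the value that continues the sequence
(`exists_isLogQuotient_psiTilde`, `exists_logQuotient_one_add`, `exists_coeff_hypG_eq`).

A congruence of `k` modulo `p ^ (e + 1)` is one of `m` modulo `p ^ e`, so `D` and `Γ` must gain a
factor `p`. `D` always does; `Γ` does for `c ∈ 1 + 2pW`. For `p = 2` and `c ∈ 1 + 2W` the gain may
fail, and only `p q_k` is controlled, which costs one power of `p`. -/

/-- `q` is compatible with all congruences modulo powers of `p`. -/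
def PreservesCongr (p : ℕ) (q : ℕ → R) : Prop :=
  ∀ e k k' : ℕ, k ≡ k' [MOD p ^ e] → (p : R) ^ e ∣ q k - q k'

/-- A sequence cut off at `m`. -/
def cutoff (m : ℕ) (u : ℕ → R) (k : ℕ) : R := if k < m then u k else 0

theorem PreservesCongr.mul {p : ℕ} {u v : ℕ → R} (hu : PreservesCongr p u)
    (hv : PreservesCongr p v) : PreservesCongr p (fun k => u k * v k) := fun e k k' h => by
  have : u k * v k - u k' * v k' = (u k - u k') * v k + u k' * (v k - v k') := by ring
  simp only [this]
  exact dvd_add ((hu e k k' h).mul_right _) ((hv e k k' h).mul_left _)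

theorem PreservesCongr.prod {p : ℕ} {ι : Type*} (s : Finset ι) {u : ι → ℕ → R}
    (hu : ∀ i ∈ s, PreservesCongr p (u i)) : PreservesCongr p (fun k => ∏ i ∈ s, u i k) := by
  classical
  induction s using Finset.induction_on with
  | empty => intro e k k' _; simp
  | insert i s hi ih =>
    simp only [Finset.prod_insert hi]
    exact (hu i (Finset.mem_insert_self _ _)).mul
      (ih fun j hj => hu j (Finset.mem_insert_of_mem hj))

theorem PreservesCongr.map {p : ℕ} {S : Type*} [CommRing S] (φ : R →+* S) {u : ℕ → R}
    (hu : PreservesCongr p u) : PreservesCongr p (fun k => φ (u k)) := fun e k k' h => by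
  simpa using map_dvd φ (hu e k k' h)

theorem preservesCongr_of_le {p : ℕ} {q : ℕ → R}
    (h : ∀ e : ℕ, e ≠ 0 → ∀ k x : ℕ, (p : R) ^ e ∣ q (k + p ^ e * x) - q k) :
    PreservesCongr p q := by
  have h' : ∀ e k k' : ℕ, k ≤ k' → k ≡ k' [MOD p ^ e] → (p : R) ^ e ∣ q k' - q k := by
    intro e k k' hle hk
    rcases eq_or_ne e 0 with rfl | he
    · simp
    · obtain ⟨x, hx⟩ := (Nat.modEq_iff_dvd' hle).mp hk
      have : k' = k + p ^ e * x := by omega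
      rw [this]
      exact h e he k x
  intro e k k' hk
  rcases le_total k k' with hle | hle
  · rw [dvd_sub_comm]
    exact h' e k k' hle hk
  · exact h' e k' k hle hk.symm

/-- A tower of sequences in which each one is a multiple of the next one, read at `⌊k / p⌋`, by a
factor compatible with congruences. -/
structure IsDworkTower (p : ℕ) (C d : ℕ → ℕ → R) : Prop where
  zero : ∀ j, C j 0 = 1
  eq_mul : ∀ j k, C j k = d j k * C (j + 1) (k / p)
  congr : ∀ j, PreservesCongr p (d j)

theorem mk_eq_sum_X_pow_mul_expand {p : ℕ} (hp : p ≠ 0) (u : ℕ → R) :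
    mk u = ∑ a ∈ Finset.range p,
      X ^ a * PowerSeries.expand p hp (mk fun x => u (a + p * x)) := by
  ext k
  have hlt : k % p < p := Nat.mod_lt _ (Nat.pos_of_ne_zero hp)
  rw [map_sum, Finset.sum_eq_single (k % p)]
  · have hk : k = p * (k / p) + k % p := (Nat.div_add_mod k p).symm
    conv_rhs => rw [hk, Nat.mul_add_mod, Nat.mod_mod, coeff_X_pow_mul, coeff_expand_mul]
    rw [coeff_mk, coeff_mk, Nat.mod_add_div]
  · intro a ha hne
    rw [coeff_X_pow_mul']
    split_ifs with hak
    · rw [coeff_expand_of_not_dvd]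
      rintro ⟨y, hy⟩
      apply hne
      have : k = a + p * y := by omega
      rw [this, Nat.add_mul_mod_self_left, Nat.mod_eq_of_lt (Finset.mem_range.mp ha)]
    · rfl
  · intro h
    exact absurd (Finset.mem_range.mpr hlt) h

theorem mk_cutoff_eq_sum {p : ℕ} (hp : p ≠ 0) (n : ℕ) (u : ℕ → R) :
    mk (cutoff (p ^ (n + 1)) u) = ∑ a ∈ Finset.range p,
      X ^ a * PowerSeries.expand p hp (mk (cutoff (p ^ n) fun x => u (a + p * x))) := by
  rw [mk_eq_sum_X_pow_mul_expand hp]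
  refine Finset.sum_congr rfl fun a ha => ?_
  congr 3
  ext x
  have ha := Finset.mem_range.mp ha
  have : a + p * x < p ^ (n + 1) ↔ x < p ^ n := by
    rw [pow_succ']
    constructor
    · intro h
      exact lt_of_mul_lt_mul_left (lt_of_le_of_lt (Nat.le_add_left _ _) h) (Nat.zero_le p)
    · intro h
      calc a + p * x < p * (x + 1) := by rw [mul_add]; omega
        _ ≤ p * p ^ n := Nat.mul_le_mul_left _ h
  simp only [cutoff, this]

variable [IsDomain R] [CharZero R]

/-- Dwork's congruence: for a factor `q` compatible with congruences, the quotient of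
`∑ C_k q_k t ^ k` by `∑ C_k t ^ k` agrees with that of the truncations. -/
theorem dvd_mul_cutoff_sub_of_isDworkTower {p : ℕ} (hp : p ≠ 0) {C d : ℕ → ℕ → R}
    (h : IsDworkTower p C d) (n : ℕ) : ∀ (j : ℕ) (q : ℕ → R), PreservesCongr p q →
      (p : R⟦X⟧) ^ n ∣ (mk fun k => C j k * q k) * mk (cutoff (p ^ n) (C j)) -
        mk (cutoff (p ^ n) fun k => C j k * q k) * mk (C j) := by
  induction n with
  | zero => intro j q _; simp
  | succ n ih =>
    intro j
    set f := mk (C (j + 1)) with hf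
    set f' := mk (cutoff (p ^ n) (C (j + 1))) with hf'
    set P := PowerSeries.expand p hp f with hP
    set P' := PowerSeries.expand p hp f' with hP'
    have hpR : (p : R) ≠ 0 := Nat.cast_ne_zero.mpr hp
    have hunit : IsUnit P := by
      apply IsUnit.map
      rw [PowerSeries.isUnit_iff_constantCoeff, ← coeff_zero_eq_constantCoeff_apply, hf, coeff_mk,
        h.zero]
      exact isUnit_one
    -- Both quotients are compared with `P = f(t ^ p)`, `f` being the series one level up; `P` is
    -- eliminated at the end.
    have key : ∀ q : ℕ → R, PreservesCongr p q →
        (p : R⟦X⟧) ^ (n + 1) ∣ (mk fun k => C j k * q k) * P' -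
          mk (cutoff (p ^ (n + 1)) fun k => C j k * q k) * P := by
      intro q hq
      rw [mk_eq_sum_X_pow_mul_expand hp, mk_cutoff_eq_sum hp, Finset.sum_mul, Finset.sum_mul,
        ← Finset.sum_sub_distrib]
      refine Finset.dvd_sum fun a ha => ?_
      have ha := Finset.mem_range.mp ha
      have hdiv : ∀ x, (a + p * x) / p = x := fun x => by
        rw [Nat.add_mul_div_left _ _ (Nat.pos_of_ne_zero hp), Nat.div_eq_of_lt ha, zero_add]
      -- On the residue class of `a` the coefficients are `C (j + 1) x * Q x`. Since `x` enters
      -- through `p * x`, `Q` gains a power of `p`, so `(Q - Q 0) / p` is an admissible factor for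
      -- the induction hypothesis at level `j + 1`.
      set Q : ℕ → R := fun x => d j (a + p * x) * q (a + p * x) with hQ
      have hQc : ∀ e x x', x ≡ x' [MOD p ^ e] → (p : R) ^ (e + 1) ∣ Q x - Q x' := by
        intro e x x' hx
        refine ((h.congr j).mul hq) (e + 1) _ _ (Nat.ModEq.add_left _ ?_)
        rw [pow_succ']
        exact Nat.ModEq.mul_left' p hx
      have hβ : ∀ x, ∃ b, Q x - Q 0 = p * b := fun x => by
        have h0 := hQc 0 x 0 (by simp [Nat.modEq_one])
        rwa [zero_add, pow_one] at h0
      choose β hβ using hβ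
      have hβc : PreservesCongr p β := by
        intro e x x' hx
        have h1 := hQc e x x' hx
        have h2 : Q x - Q x' = p * (β x - β x') := by rw [mul_sub, ← hβ, ← hβ]; ring
        rw [h2, pow_succ'] at h1
        exact (mul_dvd_mul_iff_left hpR).mp h1
      obtain ⟨w, hw⟩ := ih (j + 1) β hβc
      have e1 : (mk fun x => C j (a + p * x) * q (a + p * x)) =
          PowerSeries.C (Q 0) * f + (p : R⟦X⟧) * mk fun k => C (j + 1) k * β k := by
        ext x
        have hpC : (p : R⟦X⟧) = PowerSeries.C (p : R) := by simp
        rw [hpC, map_add, coeff_C_mul, coeff_C_mul, coeff_mk, coeff_mk, coeff_mk, h.eq_mul, hdiv]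
        have := hβ x
        simp only [hQ] at this ⊢
        linear_combination C (j + 1) x * this
      have e2 : (mk (cutoff (p ^ n) fun x => C j (a + p * x) * q (a + p * x))) =
          PowerSeries.C (Q 0) * f' +
            (p : R⟦X⟧) * mk (cutoff (p ^ n) fun k => C (j + 1) k * β k) := by
        ext x
        have hpC : (p : R⟦X⟧) = PowerSeries.C (p : R) := by simp
        rw [hpC, map_add, coeff_C_mul, coeff_C_mul, coeff_mk, coeff_mk, coeff_mk]
        simp only [cutoff]
        split_ifs with hx
        · rw [h.eq_mul, hdiv]
          have := hβ x
          simp only [hQ] at this ⊢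
          linear_combination C (j + 1) x * this
        · simp
      rw [e1, e2, hP, hP', mul_assoc, mul_assoc, ← mul_sub, ← map_mul, ← map_mul, ← map_sub]
      have e3 : (PowerSeries.C (Q 0) * f + (p : R⟦X⟧) * mk fun k => C (j + 1) k * β k) * f' -
          (PowerSeries.C (Q 0) * f' +
            (p : R⟦X⟧) * mk (cutoff (p ^ n) fun k => C (j + 1) k * β k)) * f =
          (p : R⟦X⟧) ^ (n + 1) * w := by
        rw [pow_succ', mul_assoc, ← hw]
        ring
      rw [e3, map_mul, map_pow, map_natCast]
      exact (dvd_mul_right _ _).mul_left _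
    intro q hq
    -- With `q` and the constant `1` both compared with `P`, cross-multiplication cancels `P'`, and
    -- the unit `P` can be divided out.
    have k1 := key q hq
    have k2 := key (fun _ => 1) (fun e k k' _ => by simp)
    simp only [mul_one] at k2
    rw [← hunit.dvd_mul_left]
    have e : ∀ F F' G G' : R⟦X⟧, P * (G * F' - G' * F) =
        F * (G * P' - G' * P) - G * (F * P' - F' * P) := fun F F' G G' => by ring
    rw [e]
    exact dvd_sub (k1.mul_left _) (k2.mul_left _)

end Tower

/-! ### Factorisation of Pochhammer symbols over `ℤ_p` -/

section Pochhammer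

variable {p : ℕ} [Fact p.Prime]

/-- The shift `l` in the Dwork prime `a' = (a + l) / p`. -/
def dworkShift (a : ℤ_[p]) : ℕ := (exists_dworkPrime p a).choose_spec.choose

theorem dworkShift_lt (a : ℤ_[p]) : dworkShift a < p :=
  (exists_dworkPrime p a).choose_spec.choose_spec.1

theorem mul_dworkPrime (a : ℤ_[p]) : (p : ℤ_[p]) * dworkPrime p a = a + dworkShift a :=
  (exists_dworkPrime p a).choose_spec.choose_spec.2

theorem natCast_p_ne_zero : (p : ℤ_[p]) ≠ 0 :=
  Nat.cast_ne_zero.mpr (Fact.out : p.Prime).ne_zero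

theorem natCast_dvd_natCast_iff (n : ℕ) : (p : ℤ_[p]) ∣ (n : ℤ_[p]) ↔ p ∣ n := by
  have := PadicInt.pow_p_dvd_int_iff (p := p) 1 n
  simpa [Int.natCast_dvd_natCast] using this

theorem isUnit_iff_not_dvd (x : ℤ_[p]) : IsUnit x ↔ ¬ (p : ℤ_[p]) ∣ x := by
  rw [← PadicInt.norm_lt_one_iff_dvd, PadicInt.isUnit_iff, not_lt]
  exact ⟨fun h => h.ge, fun h => le_antisymm (PadicInt.norm_le_one x) h⟩

/-- Each block of `p` consecutive terms contains exactly one multiple of `p`, always at the same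
position. -/
theorem dvd_add_natCast_iff (a : ℤ_[p]) (m : ℕ) {j : ℕ} (hj : j < p) :
    (p : ℤ_[p]) ∣ a + ((p * m + j : ℕ) : ℤ_[p]) ↔ j = dworkShift a := by
  have h : a + ((p * m + j : ℕ) : ℤ_[p]) =
      p * (dworkPrime p a + m) + (((j : ℤ) - (dworkShift a : ℤ) : ℤ) : ℤ_[p]) := by
    push_cast
    rw [mul_add, mul_dworkPrime]
    ring
  rw [h, dvd_add_right (dvd_mul_right _ _)]
  have h1 := PadicInt.pow_p_dvd_int_iff (p := p) 1 ((j : ℤ) - (dworkShift a : ℤ))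
  rw [pow_one, pow_one] at h1
  rw [h1]
  have hl := dworkShift_lt a
  constructor
  · intro hd
    have := Int.eq_zero_of_abs_lt_dvd hd (by rw [abs_lt]; omega)
    omega
  · intro hd
    simp [hd]

theorem dworkShift_one : dworkShift (1 : ℤ_[p]) = p - 1 := by
  have hp := (Fact.out : p.Prime).pos
  rw [eq_comm, ← dvd_add_natCast_iff 1 0 (by omega)]
  rw [mul_zero, zero_add, Nat.cast_sub hp, Nat.cast_one, add_sub_cancel]

/-- Since `1` is its own Dwork prime, `k!` reduces to `⌊k / p⌋!` under the same factorisation as the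
numerators. -/
theorem dworkPrime_one : dworkPrime p (1 : ℤ_[p]) = 1 := by
  have h := mul_dworkPrime (1 : ℤ_[p])
  rw [dworkShift_one, Nat.cast_sub (Fact.out : p.Prime).pos, Nat.cast_one, add_sub_cancel] at h
  exact mul_left_cancel₀ natCast_p_ne_zero (by rw [h, mul_one])

open Classical in
/-- `x` if `x` is a unit, and `1` otherwise. -/
def unitPart (x : ℤ_[p]) : ℤ_[p] := if (p : ℤ_[p]) ∣ x then 1 else x

open Classical in
/-- `1` if `x` is a unit, and `x` otherwise. -/
def nonunitPart (x : ℤ_[p]) : ℤ_[p] := if (p : ℤ_[p]) ∣ x then x else 1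

theorem unitPart_mul_nonunitPart (x : ℤ_[p]) : unitPart x * nonunitPart x = x := by
  unfold unitPart nonunitPart
  split_ifs <;> simp

theorem isUnit_unitPart (x : ℤ_[p]) : IsUnit (unitPart x) := by
  unfold unitPart
  split_ifs with h
  · exact isUnit_one
  · exact (isUnit_iff_not_dvd x).mpr h

/-- The product of the units among `a, a + 1, …, a + k - 1`. -/
def pochUnits (a : ℤ_[p]) (k : ℕ) : ℤ_[p] := ∏ j ∈ Finset.range k, unitPart (a + j)

theorem isUnit_pochUnits (a : ℤ_[p]) (k : ℕ) : IsUnit (pochUnits a k) := by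
  rw [pochUnits, IsUnit.prod_iff]
  exact fun j _ => isUnit_unitPart _

theorem pochUnits_add (a : ℤ_[p]) (k m : ℕ) :
    pochUnits a (k + m) = pochUnits a k * pochUnits (a + (k : ℤ_[p])) m := by
  simp only [pochUnits, Finset.prod_range_add, Nat.cast_add, add_assoc]

theorem prod_nonunitPart_block (a : ℤ_[p]) (m : ℕ) {b : ℕ} (hb : b ≤ p) :
    ∏ j ∈ Finset.range b, nonunitPart (a + ((p * m + j : ℕ) : ℤ_[p])) =
      if dworkShift a < b then p * (dworkPrime p a + (m : ℤ_[p])) else 1 := by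
  have h : ∀ j ∈ Finset.range b, nonunitPart (a + ((p * m + j : ℕ) : ℤ_[p])) =
      if j = dworkShift a then p * (dworkPrime p a + (m : ℤ_[p])) else 1 := by
    intro j hj
    have hj := Finset.mem_range.mp hj
    unfold nonunitPart
    simp only [dvd_add_natCast_iff a m (hj.trans_le hb)]
    split_ifs with h
    · rw [mul_add, mul_dworkPrime, h]
      push_cast
      ring
    · rfl
  rw [Finset.prod_congr rfl h, Finset.prod_ite_eq']
  simp only [Finset.mem_range]

theorem prod_nonunitPart_mul (a : ℤ_[p]) (m : ℕ) :
    ∏ j ∈ Finset.range (p * m), nonunitPart (a + (j : ℤ_[p])) =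
      p ^ m * ∏ i ∈ Finset.range m, (dworkPrime p a + (i : ℤ_[p])) := by
  induction m with
  | zero => simp
  | succ m ih =>
    rw [mul_add, mul_one, Finset.prod_range_add, ih, prod_nonunitPart_block a m le_rfl,
      if_pos (dworkShift_lt a), Finset.prod_range_succ, pow_succ]
    ring

/-- The part of the last, incomplete block of `a (a + 1) ⋯ (a + k - 1)` that is divisible by
`p`. -/
def lastFactor (a : ℤ_[p]) (k : ℕ) : ℤ_[p] :=
  if dworkShift a < k % p then p * (dworkPrime p a + ((k / p : ℕ) : ℤ_[p])) else 1

theorem prod_add_eq (a : ℤ_[p]) (k : ℕ) :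
    ∏ j ∈ Finset.range k, (a + (j : ℤ_[p])) = pochUnits a k * lastFactor a k *
      (p ^ (k / p) * ∏ i ∈ Finset.range (k / p), (dworkPrime p a + (i : ℤ_[p]))) := by
  have h : ∏ j ∈ Finset.range k, (a + (j : ℤ_[p])) =
      pochUnits a k * ∏ j ∈ Finset.range k, nonunitPart (a + (j : ℤ_[p])) := by
    rw [pochUnits, ← Finset.prod_mul_distrib]
    exact Finset.prod_congr rfl fun j _ => (unitPart_mul_nonunitPart _).symm
  have hk : ∏ j ∈ Finset.range k, nonunitPart (a + (j : ℤ_[p])) =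
      ∏ j ∈ Finset.range (p * (k / p) + k % p), nonunitPart (a + (j : ℤ_[p])) := by
    rw [Nat.div_add_mod]
  rw [h, hk, Finset.prod_range_add, prod_nonunitPart_mul,
    prod_nonunitPart_block a _ (Nat.mod_lt _ (Fact.out : p.Prime).pos).le, lastFactor]
  ring

/-- For `a = 1` the multiple of `p` ends its block, so an incomplete block contains none. -/
theorem lastFactor_one (k : ℕ) : lastFactor (1 : ℤ_[p]) k = 1 := by
  have hp := (Fact.out : p.Prime).pos
  have := Nat.mod_lt k hp
  rw [lastFactor, dworkShift_one, if_neg (by omega)]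

theorem ascPochhammer_eval_eq_prod {R : Type*} [CommRing R] (a : R) (k : ℕ) :
    (ascPochhammer R k).eval a = ∏ j ∈ Finset.range k, (a + (j : R)) := by
  induction k with
  | zero => simp
  | succ k ih => rw [ascPochhammer_succ_eval, ih, Finset.prod_range_succ]

theorem factorial_mul_multichoose (a : ℤ_[p]) (k : ℕ) :
    (k.factorial : ℤ_[p]) * Ring.multichoose a k = ∏ j ∈ Finset.range k, (a + (j : ℤ_[p])) := by
  rw [← nsmul_eq_mul, Ring.factorial_nsmul_multichoose_eq_ascPochhammer,
    Polynomial.ascPochhammer_smeval_eq_eval, ascPochhammer_eval_eq_prod]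

theorem prod_one_add (k : ℕ) :
    ∏ j ∈ Finset.range k, ((1 : ℤ_[p]) + (j : ℤ_[p])) = (k.factorial : ℤ_[p]) := by
  rw [← Finset.prod_range_add_one_eq_factorial]
  push_cast
  exact Finset.prod_congr rfl fun j _ => add_comm _ _

theorem factorial_eq (k : ℕ) :
    (k.factorial : ℤ_[p]) =
      pochUnits (1 : ℤ_[p]) k * ((p : ℤ_[p]) ^ (k / p) * ((k / p).factorial : ℤ_[p])) := by
  rw [← prod_one_add, prod_add_eq, dworkPrime_one, prod_one_add, lastFactor_one, mul_one]

/-- The quotient of the units among `a, …, a + k - 1` by those among `1, …, k`. -/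
def unitRatio (a : ℤ_[p]) (k : ℕ) : ℤ_[p] := pochUnits a k * Ring.inverse (pochUnits 1 k)

theorem unitRatio_mul (a : ℤ_[p]) (k : ℕ) : unitRatio a k * pochUnits 1 k = pochUnits a k := by
  rw [unitRatio, mul_assoc, Ring.inverse_mul_cancel _ (isUnit_pochUnits 1 k), mul_one]

theorem isUnit_unitRatio (a : ℤ_[p]) (k : ℕ) : IsUnit (unitRatio a k) :=
  isUnit_of_mul_isUnit_left (unitRatio_mul a k ▸ isUnit_pochUnits a k)

/-- The quotient of `(a)_k / k!` by `(a')_m / m!`, where `m = ⌊k / p⌋`. -/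
def dworkFactor (a : ℤ_[p]) (k : ℕ) : ℤ_[p] := unitRatio a k * lastFactor a k

theorem multichoose_eq_dworkFactor_mul (a : ℤ_[p]) (k : ℕ) :
    Ring.multichoose a k = dworkFactor a k * Ring.multichoose (dworkPrime p a) (k / p) := by
  have h0 : (k.factorial : ℤ_[p]) ≠ 0 := Nat.cast_ne_zero.mpr (Nat.factorial_ne_zero k)
  apply mul_left_cancel₀ h0
  rw [factorial_mul_multichoose, prod_add_eq, ← factorial_mul_multichoose, factorial_eq k,
    dworkFactor, ← unitRatio_mul]
  ring

theorem dworkFactor_mul_left (a : ℤ_[p]) (m : ℕ) :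
    dworkFactor a (p * m) = unitRatio a (p * m) := by
  rw [dworkFactor, lastFactor, Nat.mul_mod_right, if_neg (Nat.not_lt_zero _), mul_one]

/-! ### Congruences -/

theorem toZModPow_eq_iff {e : ℕ} {x y : ℤ_[p]} :
    PadicInt.toZModPow e x = PadicInt.toZModPow e y ↔ (p : ℤ_[p]) ^ e ∣ x - y := by
  rw [← sub_eq_zero, ← map_sub, ← RingHom.mem_ker, PadicInt.ker_toZModPow,
    Ideal.mem_span_singleton]

theorem toZModPow_unitPart {e : ℕ} (he : e ≠ 0) {x y : ℤ_[p]}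
    (h : PadicInt.toZModPow e x = PadicInt.toZModPow e y) :
    PadicInt.toZModPow e (unitPart x) = PadicInt.toZModPow e (unitPart y) := by
  have hxy : (p : ℤ_[p]) ∣ x ↔ (p : ℤ_[p]) ∣ y :=
    (dvd_iff_dvd_of_dvd_sub ((dvd_pow_self _ he).trans (toZModPow_eq_iff.mp h)))
  by_cases hx : (p : ℤ_[p]) ∣ x
  · rw [unitPart, unitPart, if_pos hx, if_pos (hxy.mp hx)]
  · rw [unitPart, unitPart, if_neg hx, if_neg (hxy.not.mp hx), h]

theorem toZModPow_pochUnits_congr {e : ℕ} (he : e ≠ 0) {x y : ℤ_[p]}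
    (h : PadicInt.toZModPow e x = PadicInt.toZModPow e y) (k : ℕ) :
    PadicInt.toZModPow e (pochUnits x k) = PadicInt.toZModPow e (pochUnits y k) := by
  simp only [pochUnits, map_prod]
  exact Finset.prod_congr rfl fun j _ => toZModPow_unitPart he (by simp only [map_add, h])

/-- Sliding a window of length `p ^ e` by one trades the term `n` for `n + p ^ e`, which has the
same unit part modulo `p ^ e`. -/
theorem toZModPow_pochUnits_natCast {e : ℕ} (he : e ≠ 0) (n : ℕ) :
    PadicInt.toZModPow e (pochUnits (n : ℤ_[p]) (p ^ e)) =
      PadicInt.toZModPow e (pochUnits (0 : ℤ_[p]) (p ^ e)) := by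
  induction n with
  | zero => simp
  | succ n ih =>
    rw [← ih]
    have h1 := pochUnits_add (n : ℤ_[p]) 1 (p ^ e)
    have h2 := pochUnits_add (n : ℤ_[p]) (p ^ e) 1
    have hs : ∀ x : ℤ_[p], pochUnits x 1 = unitPart x := fun x => by simp [pochUnits]
    rw [hs] at h1 h2
    rw [add_comm 1, h2] at h1
    have h3 : PadicInt.toZModPow e (unitPart ((n : ℤ_[p]) + ((p ^ e : ℕ) : ℤ_[p]))) =
        PadicInt.toZModPow e (unitPart (n : ℤ_[p])) :=
      toZModPow_unitPart he (by rw [toZModPow_eq_iff]; simp)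
    have h4 := congrArg (PadicInt.toZModPow e) h1
    rw [map_mul, map_mul, h3, mul_comm] at h4
    simpa using (((isUnit_unitPart (n : ℤ_[p])).map (PadicInt.toZModPow e)).mul_left_cancel
      h4).symm

theorem toZModPow_pochUnits_pow {e : ℕ} (he : e ≠ 0) (x : ℤ_[p]) :
    PadicInt.toZModPow e (pochUnits x (p ^ e)) =
      PadicInt.toZModPow e (pochUnits (0 : ℤ_[p]) (p ^ e)) := by
  rw [← toZModPow_pochUnits_natCast he (PadicInt.appr x e)]
  refine toZModPow_pochUnits_congr he ?_ _
  rw [toZModPow_eq_iff, ← Ideal.mem_span_singleton]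
  exact PadicInt.appr_spec e x

theorem toZModPow_pochUnits_add_mul {e : ℕ} (he : e ≠ 0) (a : ℤ_[p]) (k x : ℕ) :
    PadicInt.toZModPow e (pochUnits a (k + p ^ e * x)) =
      PadicInt.toZModPow e (pochUnits a k) *
        PadicInt.toZModPow e (pochUnits (0 : ℤ_[p]) (p ^ e)) ^ x := by
  induction x with
  | zero => simp
  | succ x ih =>
    rw [mul_add, mul_one, ← add_assoc, pochUnits_add, map_mul, ih,
      toZModPow_pochUnits_pow he (a + ((k + p ^ e * x : ℕ) : ℤ_[p])),
      pow_succ, mul_assoc]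

/-- Lengthening by `p ^ e * x` multiplies numerator and denominator by the same unit modulo `p ^ e`,
whatever `a` is. -/
theorem preservesCongr_unitRatio (a : ℤ_[p]) : PreservesCongr p (unitRatio a) := by
  refine preservesCongr_of_le fun e he k x => ?_
  rw [← toZModPow_eq_iff]
  have h1 := congrArg (PadicInt.toZModPow e) (unitRatio_mul a (k + p ^ e * x))
  have h2 := congrArg (PadicInt.toZModPow e) (unitRatio_mul a k)
  rw [map_mul, toZModPow_pochUnits_add_mul he, toZModPow_pochUnits_add_mul he, ← h2, map_mul,
    mul_assoc] at h1
  refine IsUnit.mul_right_cancel ?_ h1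
  exact ((isUnit_pochUnits _ _).map _).mul (((isUnit_pochUnits _ _).map _).pow x)

theorem preservesCongr_lastFactor (a : ℤ_[p]) : PreservesCongr p (lastFactor a) := by
  refine preservesCongr_of_le fun e he k x => ?_
  obtain ⟨e, rfl⟩ := Nat.exists_eq_succ_of_ne_zero he
  have hp := (Fact.out : p.Prime).pos
  have hk : k + p ^ (e + 1) * x = k + p * (p ^ e * x) := by ring
  rw [Nat.succ_eq_add_one, hk, lastFactor, lastFactor, Nat.add_mul_mod_self_left,
    Nat.add_mul_div_left _ _ hp]
  split_ifs
  · rw [← mul_sub, pow_succ']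
    refine mul_dvd_mul_left _ ⟨x, ?_⟩
    push_cast
    ring
  · simp

theorem preservesCongr_dworkFactor (a : ℤ_[p]) : PreservesCongr p (dworkFactor a) :=
  (preservesCongr_unitRatio a).mul (preservesCongr_lastFactor a)

end Pochhammer

/-! ### Difference quotients of exponential type -/

section LogQuotient

variable {R : Type*} [CommRing R]

/-- The function `P` satisfies `v m = 1 + p m P m`, and `p ^ (e + 1)` divides `P m - P m'` when
`p ^ e` divides `m - m'`. So `P` extends `(v m - 1) / (p m)` continuously to `m = 0`. -/
structure IsLogQuotient (p : ℕ) (v P : ℕ → R) : Prop where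
  eq : ∀ m : ℕ, v m = 1 + p * m * P m
  congr : ∀ e m m' : ℕ, m ≡ m' [MOD p ^ e] → (p : R) ^ (e + 1) ∣ P m - P m'

theorem pow_dvd_natCast_sub_of_modEq {p e m m' : ℕ} (h : m ≡ m' [MOD p ^ e]) :
    (p : R) ^ e ∣ (m : R) - m' := by
  obtain ⟨z, hz⟩ := h.symm.dvd
  refine ⟨(z : R), ?_⟩
  have := congrArg (Int.cast : ℤ → R) hz
  push_cast at this
  exact this

theorem IsLogQuotient.mul {p : ℕ} {v v' P P' : ℕ → R} (h : IsLogQuotient p v P)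
    (h' : IsLogQuotient p v' P') : IsLogQuotient p (fun m => v m * v' m)
      (fun m => P m + P' m + p * m * (P m * P' m)) where
  eq m := by
    simp only [h.eq, h'.eq]
    ring
  congr e m k hmk := by
    have e1 : P m + P' m + p * m * (P m * P' m) - (P k + P' k + p * k * (P k * P' k)) =
        (P m - P k) + (P' m - P' k) + (p * (m - k)) * (P m * P' m) +
          p * k * P' m * (P m - P k) + p * k * P k * (P' m - P' k) := by ring
    rw [e1]
    have h1 := h.congr e m k hmk
    have h2 := h'.congr e m k hmk
    have h3 : (p : R) ^ (e + 1) ∣ p * ((m : R) - k) := by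
      rw [pow_succ']
      exact mul_dvd_mul_left _ (pow_dvd_natCast_sub_of_modEq hmk)
    exact dvd_add (dvd_add (dvd_add (dvd_add h1 h2) (h3.mul_right _)) (h1.mul_left _))
      (h2.mul_left _)

/-- The cross terms in the quotient of a product carry a factor `m`, so the values at `m = 0` simply
add, as for a logarithmic derivative. -/
theorem IsLogQuotient.exists_prod {p : ℕ} {ι : Type*} (s : Finset ι) {v P : ι → ℕ → R}
    (h : ∀ i ∈ s, IsLogQuotient p (v i) (P i)) :
    ∃ Q, IsLogQuotient p (fun m => ∏ i ∈ s, v i m) Q ∧ Q 0 = ∑ i ∈ s, P i 0 := by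
  classical
  induction s using Finset.induction_on with
  | empty => exact ⟨fun _ => 0, ⟨by simp, by simp⟩, by simp⟩
  | insert i s hi ih =>
    obtain ⟨Q, hQ, hQ0⟩ := ih fun j hj => h j (Finset.mem_insert_of_mem hj)
    refine ⟨fun m => P i m + Q m + p * m * (P i m * Q m), ?_, ?_⟩
    · simp only [Finset.prod_insert hi]
      exact (h i (Finset.mem_insert_self _ _)).mul hQ
    · simp [Finset.sum_insert hi, hQ0]

theorem IsLogQuotient.map {p : ℕ} {S : Type*} [CommRing S] (φ : R →+* S) {v P : ℕ → R}
    (h : IsLogQuotient p v P) : IsLogQuotient p (fun m => φ (v m)) (fun m => φ (P m)) where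
  eq m := by simp [h.eq]
  congr e m k hmk := by simpa using map_dvd φ (h.congr e m k hmk)

end LogQuotient

/-! ### The `p`-adic digamma function -/

section Digamma

variable {p : ℕ} [Fact p.Prime]

/-- The term `1 / k` of the digamma sum, or `0` if `p ∣ k`. -/
def harmonicTerm (p : ℕ) [Fact p.Prime] (k : ℕ) : ℤ_[p] :=
  if p ∣ k then 0 else Ring.inverse (k : ℤ_[p])

/-- The sum of `1 / k` over `1 ≤ k < n` with `p ∤ k`. -/
def harmonicSum (p : ℕ) [Fact p.Prime] (n : ℕ) : ℤ_[p] :=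
  ∑ k ∈ Finset.Ico 1 n, harmonicTerm p k

theorem unitPart_natCast_add (k m : ℕ) :
    unitPart ((k : ℤ_[p]) + ((p * m : ℕ) : ℤ_[p])) =
      unitPart (k : ℤ_[p]) * (1 + p * m * harmonicTerm p k) := by
  have h : (p : ℤ_[p]) ∣ (k : ℤ_[p]) + ((p * m : ℕ) : ℤ_[p]) ↔ p ∣ k := by
    rw [← natCast_dvd_natCast_iff, Nat.cast_mul]
    exact dvd_add_left (dvd_mul_right _ _)
  unfold unitPart harmonicTerm
  by_cases hk : p ∣ k
  · rw [if_pos (h.mpr hk), if_pos ((natCast_dvd_natCast_iff k).mpr hk), if_pos hk]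
    ring
  · rw [if_neg (h.not.mpr hk), if_neg ((natCast_dvd_natCast_iff k).not.mpr hk), if_neg hk]
    have hu : (k : ℤ_[p]) * Ring.inverse (k : ℤ_[p]) = 1 :=
      Ring.mul_inverse_cancel _ ((isUnit_iff_not_dvd _).mpr ((natCast_dvd_natCast_iff k).not.mpr hk))
    push_cast
    linear_combination (-(p : ℤ_[p]) * m) * hu

/-- The units among `1, …, n - 1 + p m` are counted in two ways, splitting the range after `n - 1`
or after `p m`. The shifted block contributes the factors `1 + p m / k`, whose quotients at `m = 0`
sum to the harmonic sum. -/
theorem unitRatio_natCast {n : ℕ} (hn : 0 < n) (m : ℕ) :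
    unitRatio (n : ℤ_[p]) (p * m) =
      ∏ k ∈ Finset.Ico 1 n, (1 + (p : ℤ_[p]) * m * harmonicTerm p k) := by
  obtain ⟨n, rfl⟩ := Nat.exists_eq_succ_of_ne_zero hn.ne'
  have h1 := pochUnits_add (1 : ℤ_[p]) n (p * m)
  have h2 := pochUnits_add (1 : ℤ_[p]) (p * m) n
  have h3 : pochUnits ((1 : ℤ_[p]) + ((p * m : ℕ) : ℤ_[p])) n = pochUnits (1 : ℤ_[p]) n *
      ∏ k ∈ Finset.Ico 1 (n + 1), (1 + (p : ℤ_[p]) * m * harmonicTerm p k) := by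
    rw [Finset.prod_Ico_eq_prod_range, add_tsub_cancel_right, pochUnits, pochUnits,
      ← Finset.prod_mul_distrib]
    refine Finset.prod_congr rfl fun j _ => ?_
    have := unitPart_natCast_add (p := p) (1 + j) m
    push_cast at this ⊢
    rw [← this]
    congr 1
    ring
  rw [add_comm n, h2, h3] at h1
  have h4 : ((n.succ : ℕ) : ℤ_[p]) = 1 + (n : ℤ_[p]) := by push_cast; ring
  rw [h4]
  refine (isUnit_pochUnits (1 : ℤ_[p]) (p * m)).mul_right_cancel ?_
  refine (isUnit_pochUnits (1 : ℤ_[p]) n).mul_left_cancel ?_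
  rw [unitRatio_mul, ← h1]
  ring

theorem exists_isLogQuotient_natCast {n : ℕ} (hn : 0 < n) :
    ∃ P, IsLogQuotient p (fun m => unitRatio (n : ℤ_[p]) (p * m)) P ∧ P 0 = harmonicSum p n := by
  simp only [unitRatio_natCast hn]
  exact IsLogQuotient.exists_prod (P := fun k _ => harmonicTerm p k) _
    fun k _ => ⟨fun _ => rfl, fun _ _ _ _ => by simp⟩

/-! ### Passage from positive integers to `p`-adic integers. -/

theorem continuous_unitPart : Continuous (unitPart : ℤ_[p] → ℤ_[p]) := by
  classical
  unfold unitPart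
  refine Continuous.if ?_ continuous_const continuous_id
  have hc : IsClopen {x : ℤ_[p] | (p : ℤ_[p]) ∣ x} := by
    have : {x : ℤ_[p] | (p : ℤ_[p]) ∣ x} = Metric.ball 0 1 := by
      ext x
      rw [Set.mem_ofPred_eq, ← PadicInt.norm_lt_one_iff_dvd, mem_ball_zero_iff]
    rw [this]
    exact IsUltrametricDist.isClopen_ball _ _
  simp [hc.frontier_eq]

theorem continuous_unitRatio (k : ℕ) : Continuous fun a : ℤ_[p] => unitRatio a k := by
  unfold unitRatio pochUnits
  exact (continuous_finsetProd _ fun j _ =>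
    continuous_unitPart.comp (continuous_id.add continuous_const)).mul continuous_const

theorem isClosed_pow_dvd (e : ℕ) : IsClosed {x : ℤ_[p] | (p : ℤ_[p]) ^ e ∣ x} := by
  have : {x : ℤ_[p] | (p : ℤ_[p]) ^ e ∣ x} = {x | ‖x‖ ≤ (p : ℝ) ^ (-e : ℤ)} := by
    ext x
    rw [Set.mem_ofPred_eq, Set.mem_ofPred_eq, PadicInt.norm_le_pow_iff_mem_span_pow,
      Ideal.mem_span_singleton]
  rw [this]
  exact isClosed_le continuous_norm continuous_const

theorem eq_zero_of_forall_pow_dvd {x : ℤ_[p]} (h : ∀ t, (p : ℤ_[p]) ^ t ∣ x) : x = 0 := by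
  by_contra hx
  have h1 := (PadicInt.mem_span_pow_iff_le_valuation x hx (x.valuation + 1)).mp
    (Ideal.mem_span_singleton.mpr (h _))
  omega

/-- `P (p ^ t)` is determined by `v`, and `P 0` is its limit as `t → ∞`. -/
theorem IsLogQuotient.zero_unique {v P P' : ℕ → ℤ_[p]} (h : IsLogQuotient p v P)
    (h' : IsLogQuotient p v P') : P 0 = P' 0 := by
  rw [← sub_eq_zero]
  refine eq_zero_of_forall_pow_dvd fun t => ?_
  have hm : P (p ^ t) = P' (p ^ t) := by
    have e1 : (1 : ℤ_[p]) + p * (p ^ t : ℕ) * P (p ^ t) = 1 + p * (p ^ t : ℕ) * P' (p ^ t) := by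
      rw [← h.eq, ← h'.eq]
    refine mul_left_cancel₀ ?_ (add_left_cancel e1)
    push_cast
    exact mul_ne_zero natCast_p_ne_zero (pow_ne_zero _ natCast_p_ne_zero)
  have h0 : (0 : ℕ) ≡ p ^ t [MOD p ^ t] := by simp [Nat.ModEq]
  have h1 := h.congr t 0 (p ^ t) h0
  have h2 := h'.congr t 0 (p ^ t) h0
  rw [hm] at h1
  have h3 := dvd_sub h1 h2
  rw [sub_sub_sub_cancel_right] at h3
  exact (pow_dvd_pow _ (Nat.le_succ t)).trans h3

/-- The filter of positive integers tending to `z ∈ ℤ_p`. -/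
def posNatNhds (z : ℤ_[p]) : Filter ℕ :=
  comap (fun n : ℕ => (n : ℤ_[p])) (𝓝 z) ⊓ 𝓟 {n : ℕ | 0 < n}

theorem tendsto_natCast_posNatNhds (z : ℤ_[p]) :
    Tendsto (fun n : ℕ => (n : ℤ_[p])) (posNatNhds z) (𝓝 z) :=
  tendsto_comap.mono_left inf_le_left

theorem eventually_pos_posNatNhds (z : ℤ_[p]) : ∀ᶠ n in posNatNhds z, 0 < n :=
  mem_inf_of_right (mem_principal_self _)

instance neBot_posNatNhds (z : ℤ_[p]) : (posNatNhds z).NeBot := by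
  rw [posNatNhds, inf_principal_neBot_iff]
  rintro U ⟨V, hV, hVU⟩
  obtain ⟨ε, hε, hball⟩ := Metric.mem_nhds_iff.mp hV
  obtain ⟨t, ht⟩ := PadicInt.exists_pow_neg_lt p hε
  -- Adding `p ^ t` keeps the approximation and makes the integer positive.
  refine ⟨PadicInt.appr z t + p ^ t, hVU (hball ?_), ?_⟩
  · rw [Metric.mem_ball, dist_comm, dist_eq_norm]
    refine lt_of_le_of_lt ?_ ht
    rw [PadicInt.norm_le_pow_iff_mem_span_pow]
    dsimp only
    rw [Nat.cast_add, ← sub_sub]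
    refine Ideal.sub_mem _ (PadicInt.appr_spec t z) ?_
    rw [Nat.cast_pow]
    exact Ideal.mem_span_singleton_self _
  · exact Nat.add_pos_right _ (pow_pos (Fact.out : p.Prime).pos _)

theorem exists_isLogQuotient_unitRatio (a : ℤ_[p]) :
    ∃ P, IsLogQuotient p (fun m => unitRatio a (p * m)) P ∧
      Tendsto (harmonicSum p) (posNatNhds a) (𝓝 (P 0)) := by
  have hP : ∀ n : ℕ, ∃ P : ℕ → ℤ_[p], 0 < n →
      IsLogQuotient p (fun m => unitRatio (n : ℤ_[p]) (p * m)) P ∧ P 0 = harmonicSum p n := by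
    intro n
    rcases Nat.eq_zero_or_pos n with rfl | hn
    · exact ⟨0, fun h => absurd h (lt_irrefl _)⟩
    · obtain ⟨P, h⟩ := exists_isLogQuotient_natCast (p := p) hn
      exact ⟨P, fun _ => h⟩
  choose P hP using hP
  -- The space of sequences `ℕ → ℤ_p` is compact, so the quotients `P n` converge pointwise along
  -- any ultrafilter; the defining identity and the congruences are closed conditions.
  have lim : ∀ U : Ultrafilter ℕ, (U : Filter ℕ) ≤ posNatNhds a →
      ∃ Q, IsLogQuotient p (fun m => unitRatio a (p * m)) Q ∧
        Tendsto (harmonicSum p) U (𝓝 (Q 0)) := by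
    intro U hU
    have hlim : Tendsto P U (𝓝 (U.map P).lim) := (U.map P).le_nhds_lim
    set Q := (U.map P).lim
    have hlim' : ∀ m, Tendsto (fun n => P n m) U (𝓝 (Q m)) := fun m =>
      (tendsto_pi_nhds.mp hlim) m
    have hpos : ∀ᶠ n in (U : Filter ℕ), 0 < n := hU (eventually_pos_posNatNhds a)
    refine ⟨Q, ⟨fun m => ?_, fun e m m' hm => ?_⟩, ?_⟩
    · have t1 : Tendsto (fun n : ℕ => unitRatio (n : ℤ_[p]) (p * m)) U
          (𝓝 (unitRatio a (p * m))) :=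
        ((continuous_unitRatio (p * m)).tendsto a).comp
          ((tendsto_natCast_posNatNhds a).mono_left hU)
      have t2 : Tendsto (fun n : ℕ => 1 + (p : ℤ_[p]) * m * P n m) U
          (𝓝 (1 + (p : ℤ_[p]) * m * Q m)) := ((hlim' m).const_mul _).const_add _
      refine tendsto_nhds_unique (t1.congr' ?_) t2
      filter_upwards [hpos] with n hn
      exact (hP n hn).1.eq m
    · refine (isClosed_pow_dvd (e + 1)).mem_of_tendsto ((hlim' m).sub (hlim' m')) ?_
      filter_upwards [hpos] with n hn
      exact (hP n hn).1.congr e m m' hm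
    · refine (hlim' 0).congr' ?_
      filter_upwards [hpos] with n hn
      exact (hP n hn).2
  obtain ⟨Q, hQ, -⟩ := lim (Ultrafilter.of (posNatNhds a)) (Ultrafilter.of_le _)
  refine ⟨Q, hQ, ?_⟩
  -- Limits along different ultrafilters agree at `0` by `IsLogQuotient.zero_unique`, which yields
  -- genuine convergence of the harmonic sums.
  rw [tendsto_iff_ultrafilter]
  intro U hU
  obtain ⟨Q', hQ', ht⟩ := lim U hU
  rwa [hQ.zero_unique hQ']

/-! ### Limits in `K` -/

theorem padicIntToW_injective : Function.Injective (padicIntToW p) :=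
  (WittVector.map_injective _ (algebraMap (ZMod p) (AlgebraicClosure (ZMod p))).injective).comp
    (WittVector.equiv p).symm.injective

instance charZero_W : CharZero (W p) :=
  charZero_of_injective_ringHom (padicIntToW_injective (p := p))

instance charZero_K : CharZero (K p) :=
  charZero_of_injective_ringHom (IsFractionRing.injective (W p) (K p))

theorem W_eq_zero_of_forall_pow_dvd {x : W p} (h : ∀ t, (p : W p) ^ t ∣ x) : x = 0 := by
  have := (inferInstance : IsHausdorff (Ideal.span {(p : W p)}) (W p)).haus x
  refine this fun t => ?_
  rw [SModEq.zero, smul_eq_mul, Ideal.mul_top, Ideal.span_singleton_pow, Ideal.mem_span_singleton]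
  exact h t

theorem IsPadicLim.unique {ι : Type*} {l : Filter ι} [l.NeBot] {x : ι → K p} {y z : K p}
    (hy : IsPadicLim p l x y) (hz : IsPadicLim p l x z) : y = z := by
  have h : ∀ t : ℕ, ∃ w : W p, y - z = (p : K p) ^ t * algebraMap (W p) (K p) w := by
    intro t
    obtain ⟨i, ⟨w, hw⟩, w', hw'⟩ := ((hy t).and (hz t)).exists
    refine ⟨w' - w, ?_⟩
    rw [map_sub, mul_sub, ← hw, ← hw']
    ring
  obtain ⟨w0, h0⟩ := h 0
  rw [pow_zero, one_mul] at h0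
  have : w0 = 0 := by
    refine W_eq_zero_of_forall_pow_dvd fun t => ?_
    obtain ⟨w, hw⟩ := h t
    refine ⟨w, IsFractionRing.injective (W p) (K p) ?_⟩
    rw [← h0, hw]
    simp
  rw [← sub_eq_zero, h0, this, map_zero]

theorem padicLim_eq {ι : Type*} {l : Filter ι} [l.NeBot] {x : ι → K p} {y : K p}
    (hy : IsPadicLim p l x y) : padicLim p l x = y := by
  have h : ∃ y, IsPadicLim p l x y := ⟨y, hy⟩
  rw [padicLim, dif_pos h]
  exact h.choose_spec.unique hy

theorem isPadicLim_of_tendsto {ι : Type*} {l : Filter ι} {x : ι → ℤ_[p]} {y : ℤ_[p]}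
    (h : Tendsto x l (𝓝 y)) :
    IsPadicLim p l (fun i => padicIntToK p (x i)) (padicIntToK p y) := by
  intro m
  have hpos : (0 : ℝ) < (p : ℝ) ^ (-m : ℤ) :=
    zpow_pos (Nat.cast_pos.mpr (Fact.out : p.Prime).pos) _
  filter_upwards [h (Metric.closedBall_mem_nhds y hpos)] with i hi
  rw [Set.mem_preimage, mem_closedBall_iff_norm, PadicInt.norm_le_pow_iff_mem_span_pow,
    Ideal.mem_span_singleton] at hi
  obtain ⟨w, hw⟩ := hi
  refine ⟨padicIntToW p w, ?_⟩
  rw [← map_sub, hw, map_mul, map_pow, map_natCast]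
  rfl

theorem padicIntToK_harmonicSum (n : ℕ) : padicIntToK p (harmonicSum p n) =
    ∑ k ∈ (Finset.Ico 1 n).filter (fun k => ¬ p ∣ k), (1 : K p) / (k : K p) := by
  rw [harmonicSum, map_sum, Finset.sum_filter]
  refine Finset.sum_congr rfl fun k _ => ?_
  unfold harmonicTerm
  by_cases hk : p ∣ k
  · rw [if_pos hk, if_neg (not_not.mpr hk), map_zero]
  · rw [if_neg hk, if_pos hk]
    have hk0 : (k : K p) ≠ 0 := Nat.cast_ne_zero.mpr (by rintro rfl; exact hk (dvd_zero p))
    have hu : Ring.inverse (k : ℤ_[p]) * (k : ℤ_[p]) = 1 :=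
      Ring.inverse_mul_cancel _
        ((isUnit_iff_not_dvd _).mpr ((natCast_dvd_natCast_iff k).not.mpr hk))
    rw [eq_div_iff hk0, ← map_natCast (padicIntToK p) k, ← map_mul, hu, map_one]

theorem exists_isLogQuotient_psiTilde (a : ℤ_[p]) :
    ∃ P, IsLogQuotient p (fun m => unitRatio a (p * m)) P ∧
      psiTilde p a = padicIntToK p (P 0) := by
  obtain ⟨P, hP, ht⟩ := exists_isLogQuotient_unitRatio a
  refine ⟨P, hP, ?_⟩
  have := isPadicLim_of_tendsto ht
  simp only [padicIntToK_harmonicSum] at this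
  exact padicLim_eq (l := posNatNhds a) this

end Digamma

/-! ### The logarithm of a one-unit -/

section Logarithm

variable {p : ℕ} [Fact p.Prime]

theorem isUnit_natCast_W {n : ℕ} (h : ¬ p ∣ n) : IsUnit (n : W p) := by
  rw [← map_natCast (padicIntToW p)]
  exact ((isUnit_iff_not_dvd _).mpr ((natCast_dvd_natCast_iff n).not.mpr h)).map _

theorem W_p_ne_zero : (p : W p) ≠ 0 := Nat.cast_ne_zero.mpr (Fact.out : p.Prime).ne_zero

theorem not_isUnit_W_p : ¬ IsUnit (p : W p) := (WittVector.irreducible p).not_isUnit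

theorem natCast_dvd_p_pow {n N : ℕ} (hn : n ≠ 0) (h : padicValNat p n ≤ N) :
    (n : W p) ∣ (p : W p) ^ N := by
  obtain ⟨k, u, hu, hk⟩ := Nat.exists_eq_pow_mul_and_not_dvd hn p (Fact.out : p.Prime).ne_one
  have hu0 : u ≠ 0 := by rintro rfl; exact hu (dvd_zero p)
  have hv : padicValNat p n = k := by
    rw [hk, padicValNat.mul (pow_ne_zero _ (Fact.out : p.Prime).ne_zero) hu0,
      padicValNat.prime_pow, padicValNat.eq_zero_of_not_dvd hu, add_zero]
  rw [hk, Nat.cast_mul, (isUnit_natCast_W hu).mul_right_dvd, Nat.cast_pow]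
  exact pow_dvd_pow _ (hv ▸ h)

/-- The valuation grows at most logarithmically: `2 ^ v ≤ p ^ v ≤ k + 1` is incompatible with `v > k
- M ≥ k / 2`. -/
theorem padicValNat_succ_add_le {k M : ℕ} (h : 2 * M ≤ k) :
    padicValNat p (k + 1) + M ≤ k := by
  by_contra hlt
  have h1 : p ^ padicValNat p (k + 1) ≤ k + 1 := Nat.le_of_dvd k.succ_pos pow_padicValNat_dvd
  have h2 : 2 ^ padicValNat p (k + 1) ≤ p ^ padicValNat p (k + 1) :=
    Nat.pow_le_pow_left (Fact.out : p.Prime).two_le _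
  have h3 : 2 ^ (k - M + 1) ≤ 2 ^ padicValNat p (k + 1) :=
    Nat.pow_le_pow_right two_pos (by omega)
  have h4 : k - M + 1 ≤ 2 ^ (k - M) := Nat.lt_two_pow_self
  rw [pow_succ] at h3
  omega

theorem padicValNat_factorial_succ_le (k : ℕ) : padicValNat p (k + 1).factorial ≤ k := by
  have h : (p - 1) * padicValNat p (k + 1).factorial < k + 1 :=
    sub_one_mul_padicValNat_factorial_lt_of_ne_zero (p := p) k.succ_ne_zero
  have hp := (Fact.out : p.Prime).two_le
  have h1 : 1 * padicValNat p (k + 1).factorial ≤ (p - 1) * padicValNat p (k + 1).factorial :=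
    Nat.mul_le_mul_right _ (by omega)
  omega

theorem padicValNat_factorial_succ_lt (hp2 : p ≠ 2) {k : ℕ} (hk : k ≠ 0) :
    padicValNat p (k + 1).factorial + 1 ≤ k := by
  have h : (p - 1) * padicValNat p (k + 1).factorial < k + 1 :=
    sub_one_mul_padicValNat_factorial_lt_of_ne_zero (p := p) k.succ_ne_zero
  have hp := (Fact.out : p.Prime).two_le
  have h1 : 2 * padicValNat p (k + 1).factorial ≤ (p - 1) * padicValNat p (k + 1).factorial :=
    Nat.mul_le_mul_right _ (by omega)
  omega

theorem exists_logTerm (ε : W p) (k : ℕ) :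
    ∃ t : W p, ((k + 1 : ℕ) : W p) * t = p ^ k * ε ^ (k + 1) ∧
      ∀ M : ℕ, 2 * M ≤ k → (p : W p) ^ M ∣ t := by
  have hk0 : ((k + 1 : ℕ) : W p) ≠ 0 := Nat.cast_ne_zero.mpr k.succ_ne_zero
  obtain ⟨s, hs⟩ := natCast_dvd_p_pow (p := p) k.succ_ne_zero
    (by simpa using padicValNat_succ_add_le (p := p) (k := k) (M := 0) (by omega))
  refine ⟨s * ε ^ (k + 1), by rw [← mul_assoc, ← hs], fun M hM => Dvd.dvd.mul_right ?_ _⟩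
  have hpM : p ^ M ≠ 0 := pow_ne_zero _ (Fact.out : p.Prime).ne_zero
  have h := natCast_dvd_p_pow (p := p) (N := k) (mul_ne_zero k.succ_ne_zero hpM) (by
    rw [padicValNat.mul k.succ_ne_zero hpM, padicValNat.prime_pow]
    exact padicValNat_succ_add_le hM)
  rw [hs, Nat.cast_mul, Nat.cast_pow] at h
  exact (mul_dvd_mul_iff_left hk0).mp h

/-- The terms `p ^ k ε ^ (k + 1) / (k + 1)` of the logarithmic series of `1 + p ε`, divided by `p`
and up to sign. -/
def logTerm (ε : W p) (k : ℕ) : W p := (exists_logTerm ε k).choose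

theorem succ_mul_logTerm (ε : W p) (k : ℕ) :
    ((k + 1 : ℕ) : W p) * logTerm ε k = p ^ k * ε ^ (k + 1) :=
  (exists_logTerm ε k).choose_spec.1

theorem pow_dvd_logTerm (ε : W p) {k M : ℕ} (h : 2 * M ≤ k) : (p : W p) ^ M ∣ logTerm ε k :=
  (exists_logTerm ε k).choose_spec.2 M h

/-- The partial sums of the binomial expansion of `((1 + p ε) ^ m - 1) / (p m)`, a polynomial in
`m`. -/
def logPartialSum (ε : W p) (J m : ℕ) : W p :=
  ∑ k ∈ Finset.range J, ((Ring.choose ((m : ℤ) - 1) k : ℤ) : W p) * logTerm ε k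

theorem choose_natCast_succ_sub_one (m k : ℕ) :
    Ring.choose (((m + 1 : ℕ) : ℤ) - 1) k = (m.choose k : ℤ) := by
  rw [Nat.cast_add, Nat.cast_one, add_sub_cancel_right, Ring.choose_natCast]

/-- The binomial theorem combined with `C(m, k + 1) / m = C(m - 1, k) / (k + 1)`. -/
theorem one_add_pow_eq (ε : W p) {m J : ℕ} (hJ : m ≤ J) :
    (1 + p * ε) ^ m = 1 + p * m * logPartialSum ε J m := by
  cases m with
  | zero => simp
  | succ m =>
    have h1 : logPartialSum ε J (m + 1) =
        ∑ k ∈ Finset.range (m + 1), (m.choose k : W p) * logTerm ε k := by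
      unfold logPartialSum
      rw [← Finset.sum_subset (Finset.range_subset_range.mpr hJ)]
      · refine Finset.sum_congr rfl fun k _ => ?_
        rw [choose_natCast_succ_sub_one, Int.cast_natCast]
      · intro k _ hk
        rw [Finset.mem_range, not_lt] at hk
        rw [choose_natCast_succ_sub_one, Nat.choose_eq_zero_of_lt hk]
        simp
    rw [h1, add_comm 1, add_pow, Finset.sum_range_succ', Finset.mul_sum, add_comm]
    congr 1
    · simp
    · refine Finset.sum_congr rfl fun k _ => ?_
      have h2 := congrArg (Nat.cast : ℕ → W p) (Nat.add_one_mul_choose_eq m k)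
      have h3 := succ_mul_logTerm ε k
      push_cast at h2 h3 ⊢
      rw [one_pow, mul_one, mul_pow]
      linear_combination (-(p : W p) * (((m + 1).choose (k + 1) : ℕ) : W p)) * h3 -
        (p : W p) * logTerm ε k * h2

/-- At `m = 0` the binomial coefficients become the alternating signs of the logarithmic series. -/
theorem choose_neg_one (k : ℕ) : Ring.choose (((0 : ℕ) : ℤ) - 1) k = (-1) ^ k := by
  rw [Nat.cast_zero, zero_sub, Ring.choose_neg]
  simp [Ring.choose_natCast, Units.smul_def, Int.negOnePow_def]

theorem factorial_mul_choose_sub (m m' k : ℕ) : ((m : ℤ) - m') ∣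
    (k.factorial : ℤ) * (Ring.choose ((m : ℤ) - 1) k - Ring.choose ((m' : ℤ) - 1) k) := by
  have h : ∀ r : ℤ, (k.factorial : ℤ) * Ring.choose r k = (descPochhammer ℤ k).eval r := fun r => by
    rw [← nsmul_eq_mul, ← Ring.descPochhammer_eq_factorial_smul_choose,
      Polynomial.eval_eq_smeval]
  rw [mul_sub, h, h]
  simpa using Polynomial.sub_dvd_eval_sub ((m : ℤ) - 1) ((m' : ℤ) - 1) (descPochhammer ℤ k)

/-- `k! C(m - 1, k)` is an integral polynomial in `m`, hence respects congruences; `hδ` pays for the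
denominator `(k + 1)!` with `δ` powers to spare. The term `k = 0` does not depend on `m`. -/
theorem pow_dvd_logPartialSum_sub {ε : W p} {δ : ℕ}
    (hδ : ∀ k, k ≠ 0 → (p : W p) ^ δ * ((k + 1).factorial : W p) ∣ p ^ k * ε ^ (k + 1))
    (J : ℕ) {e m m' : ℕ} (h : m ≡ m' [MOD p ^ e]) :
    (p : W p) ^ (e + δ) ∣ logPartialSum ε J m - logPartialSum ε J m' := by
  unfold logPartialSum
  rw [← Finset.sum_sub_distrib]
  refine Finset.dvd_sum fun k _ => ?_
  rw [← sub_mul]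
  rcases eq_or_ne k 0 with rfl | hk
  · simp
  · obtain ⟨w, hw⟩ := hδ k hk
    obtain ⟨z, hz⟩ := factorial_mul_choose_sub m m' k
    obtain ⟨x, hx⟩ := pow_dvd_natCast_sub_of_modEq (R := W p) h
    have hz' := congrArg (Int.cast : ℤ → W p) hz
    push_cast at hz'
    refine ⟨x * z * w, ?_⟩
    have h0 : ((k + 1).factorial : W p) ≠ 0 := Nat.cast_ne_zero.mpr (Nat.factorial_ne_zero _)
    apply mul_left_cancel₀ h0
    have h3 := succ_mul_logTerm ε k
    rw [hw] at h3
    rw [hx] at hz'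
    have hf : ((k + 1).factorial : W p) = ((k + 1 : ℕ) : W p) * (k.factorial : W p) := by
      rw [Nat.factorial_succ, Nat.cast_mul]
    rw [pow_add]
    set T := ((Ring.choose ((m : ℤ) - 1) k : ℤ) : W p) -
      ((Ring.choose ((m' : ℤ) - 1) k : ℤ) : W p)
    calc ((k + 1).factorial : W p) * (T * logTerm ε k)
        = ((k.factorial : W p) * T) * (((k + 1 : ℕ) : W p) * logTerm ε k) := by rw [hf]; ring
      _ = _ := by rw [h3, hz']; ring

theorem logPartialSum_sub_dvd (ε : W p) (m : ℕ) {M J J' : ℕ} (h : 2 * M ≤ J) (h' : J ≤ J') :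
    (p : W p) ^ M ∣ logPartialSum ε J' m - logPartialSum ε J m := by
  unfold logPartialSum
  rw [← Finset.sum_Ico_eq_sub _ h']
  refine Finset.dvd_sum fun k hk => Dvd.dvd.mul_left (pow_dvd_logTerm ε ?_) _
  exact h.trans (Finset.mem_Ico.mp hk).1

theorem exists_logPartialSum_limit (ε : W p) (m : ℕ) :
    ∃ L : W p, ∀ M J : ℕ, 2 * M ≤ J → (p : W p) ^ M ∣ L - logPartialSum ε J m := by
  have hI : ∀ (n : ℕ) (x y : W p),
      x ≡ y [SMOD (Ideal.span {(p : W p)} ^ n • ⊤ : Submodule (W p) (W p))] ↔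
        (p : W p) ^ n ∣ x - y := fun n x y => by
    rw [SModEq.sub_mem, smul_eq_mul, Ideal.mul_top, Ideal.span_singleton_pow,
      Ideal.mem_span_singleton]
  obtain ⟨L, hL⟩ := (inferInstance : IsPrecomplete (Ideal.span {(p : W p)}) (W p)).prec
    (f := fun n => logPartialSum ε (2 * n) m) (fun {n n'} hn => by
      rw [hI, dvd_sub_comm]
      exact logPartialSum_sub_dvd ε m le_rfl (Nat.mul_le_mul_left 2 hn))
  refine ⟨L, fun M J hJ => ?_⟩
  have h1 := (hI M _ _).mp (hL M)
  have h2 := logPartialSum_sub_dvd ε m (M := M) le_rfl hJ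
  rw [dvd_sub_comm] at h1
  rw [← sub_sub_sub_cancel_right _ _ (logPartialSum ε (2 * M) m)]
  exact dvd_sub h1 h2

theorem logSeries_eq {ε L : W p}
    (hL : ∀ M J : ℕ, 2 * M ≤ J → (p : W p) ^ M ∣ L - logPartialSum ε J 0) :
    logSeries p (algebraMap (W p) (K p) (1 + p * ε)) = algebraMap (W p) (K p) (p * L) := by
  have hsum : ∀ N : ℕ, -∑ n ∈ Finset.Icc 1 N,
      (1 - algebraMap (W p) (K p) (1 + p * ε)) ^ n / (n : K p) =
        algebraMap (W p) (K p) (p * logPartialSum ε N 0) := by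
    intro N
    have hIcc : Finset.Icc 1 N = Finset.Ico 1 (N + 1) := rfl
    rw [hIcc, Finset.sum_Ico_eq_sum_range, add_tsub_cancel_right, logPartialSum, Finset.mul_sum,
      map_sum, ← Finset.sum_neg_distrib]
    refine Finset.sum_congr rfl fun k _ => ?_
    have hk : ((1 + k : ℕ) : K p) ≠ 0 := Nat.cast_ne_zero.mpr (by omega)
    have h3 := congrArg (algebraMap (W p) (K p)) (succ_mul_logTerm ε k)
    rw [← neg_div, div_eq_iff hk, choose_neg_one]
    simp only [map_mul, map_pow, map_natCast] at h3
    push_cast at h3 ⊢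
    rw [show 1 + k = k + 1 by omega, show (1 : K p) - (1 + p * algebraMap (W p) (K p) ε) =
      (-1) * (p * algebraMap (W p) (K p) ε) by ring, mul_pow, mul_pow]
    linear_combination (-(p : K p) * (-1) ^ k) * h3
  simp only [logSeries, hsum]
  refine padicLim_eq fun M => ?_
  filter_upwards [eventually_ge_atTop (2 * M)] with J hJ
  obtain ⟨w, hw⟩ := hL M J hJ
  refine ⟨-(p * w), ?_⟩
  rw [← map_sub, ← mul_sub, ← neg_sub L, hw]
  simp only [map_mul, map_neg, map_pow, map_natCast]
  ring

theorem not_dvd_one_add_mul (ε : W p) : ¬ (p : W p) ∣ 1 + p * ε := by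
  intro h
  rw [dvd_add_left (dvd_mul_right _ _)] at h
  exact not_isUnit_W_p (isUnit_of_dvd_one h)

theorem iwasawaLog_one_add (ε : W p) :
    iwasawaLog p (algebraMap (W p) (K p) (1 + p * ε)) =
      logSeries p (algebraMap (W p) (K p) (1 + p * ε)) := by
  classical
  have hp0 : (p : K p) ≠ 0 := Nat.cast_ne_zero.mpr (Fact.out : p.Prime).ne_zero
  have hinj := IsFractionRing.injective (W p) (K p)
  set z := algebraMap (W p) (K p) (1 + p * ε) with hz
  have hone : IsOneUnit p (z ^ 1 * (p : K p) ^ (0 : ℤ)) := ⟨ε, by simp [hz]⟩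
  have h : ∃ N : ℕ, 0 < N ∧ ∃ m : ℤ, IsOneUnit p (z ^ N * (p : K p) ^ m) := ⟨1, one_pos, 0, hone⟩
  have hN : Nat.find h = 1 := by
    refine le_antisymm (Nat.find_min' h ⟨one_pos, 0, hone⟩) (Nat.find_spec h).1
  -- The power of `p` picked by choice in `iwasawaLog` is forced to be trivial: otherwise some
  -- element of `1 + p W` would be divisible by `p`.
  have hexp : ∀ N, N = 1 → ∀ m : ℤ, IsOneUnit p (z ^ N * (p : K p) ^ m) → m = 0 := by
    rintro N rfl m ⟨e, he⟩
    rw [pow_one] at he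
    rcases lt_trichotomy m 0 with hm | hm | hm
    · exfalso
      obtain ⟨k, hk⟩ := Int.eq_ofNat_of_zero_le (show 0 ≤ -m by omega)
      have hm' : m = -(k : ℤ) := by omega
      have hk0 : k ≠ 0 := by omega
      rw [hm', zpow_neg, zpow_natCast, ← div_eq_mul_inv, div_eq_iff (pow_ne_zero _ hp0)] at he
      have : 1 + p * ε = (1 + p * e) * p ^ k := hinj (by rw [← hz, he]; simp)
      exact not_dvd_one_add_mul ε (this ▸ (dvd_pow_self _ hk0).mul_left _)
    · exact hm
    · exfalso
      obtain ⟨k, rfl⟩ := Int.eq_ofNat_of_zero_le hm.le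
      have hk0 : k ≠ 0 := by rintro rfl; simp at hm
      rw [zpow_natCast] at he
      have : (1 + p * ε) * p ^ k = 1 + p * e := hinj (by
        rw [map_mul, ← hz, map_pow, map_natCast, he]
        simp)
      exact not_dvd_one_add_mul e (this ▸ (dvd_pow_self _ hk0).mul_left _)
  have hm0 := hexp _ hN _ (Nat.find_spec h).2.choose_spec
  rw [iwasawaLog, dif_pos h, hm0, hN]
  simp

/-- The difference quotients `((1 + p ε) ^ m - 1) / (p m)` extend to `m = 0` by the logarithm. -/
theorem exists_logQuotient_one_add (ε : W p) : ∃ Γ : ℕ → W p,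
    (∀ m, (1 + p * ε) ^ m = 1 + p * m * Γ m) ∧
    (∀ δ : ℕ,
      (∀ k, k ≠ 0 → (p : W p) ^ δ * ((k + 1).factorial : W p) ∣ p ^ k * ε ^ (k + 1)) →
      ∀ e m m' : ℕ, m ≡ m' [MOD p ^ e] → (p : W p) ^ (e + δ) ∣ Γ m - Γ m') ∧
    iwasawaLog p (algebraMap (W p) (K p) (1 + p * ε)) = algebraMap (W p) (K p) (p * Γ 0) := by
  choose Γ hΓ using exists_logPartialSum_limit ε
  refine ⟨Γ, fun m => ?_, fun δ hδ e m m' h => ?_, ?_⟩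
  · rw [← sub_eq_zero]
    refine W_eq_zero_of_forall_pow_dvd fun M => ?_
    rw [one_add_pow_eq ε (J := max m (2 * M)) (le_max_left _ _), add_sub_add_left_eq_sub,
      ← mul_sub]
    refine Dvd.dvd.mul_left ?_ _
    rw [dvd_sub_comm]
    exact hΓ m M _ (le_max_right _ _)
  · have h1 := hΓ m (e + δ) _ le_rfl
    have h2 := hΓ m' (e + δ) _ le_rfl
    have h3 := pow_dvd_logPartialSum_sub hδ (2 * (e + δ)) h
    have h4 := dvd_add (dvd_sub h1 h2) h3
    convert h4 using 1
    ring
  · rw [iwasawaLog_one_add, logSeries_eq (hΓ 0)]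

/-! ### Precision of the logarithm in the two cases for `c`. -/

theorem pow_zero_mul_factorial_dvd (ε : W p) (k : ℕ) :
    (p : W p) ^ 0 * ((k + 1).factorial : W p) ∣ p ^ k * ε ^ (k + 1) := by
  rw [pow_zero, one_mul]
  exact (natCast_dvd_p_pow (Nat.factorial_ne_zero _) (padicValNat_factorial_succ_le k)).mul_right _

/-- The extra factor `p` comes from `2 * e` when `p = 2`, and from Legendre's bound on the valuation
of `(k + 1)!` when `p` is odd. -/
theorem pow_one_mul_factorial_dvd (e : W p) {k : ℕ} (hk : k ≠ 0) :
    (p : W p) ^ 1 * ((k + 1).factorial : W p) ∣ p ^ k * (2 * e) ^ (k + 1) := by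
  by_cases hp2 : p = 2
  · rw [pow_one, mul_comm]
    refine mul_dvd_mul
      (natCast_dvd_p_pow (Nat.factorial_ne_zero _) (padicValNat_factorial_succ_le k)) ?_
    have : (p : W p) = 2 := by
      have := congrArg (Nat.cast : ℕ → W p) hp2
      simpa using this
    rw [this]
    exact (dvd_mul_right _ _).trans (dvd_pow_self _ k.succ_ne_zero)
  · refine Dvd.dvd.mul_right ?_ _
    have hp0 := (Fact.out : p.Prime).ne_zero
    have := natCast_dvd_p_pow (p := p) (N := k) (mul_ne_zero hp0 (Nat.factorial_ne_zero (k + 1)))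
      (by
        rw [padicValNat.mul hp0 (Nat.factorial_ne_zero _), padicValNat_self, add_comm]
        exact padicValNat_factorial_succ_lt hp2 hk)
    simpa using this

end Logarithm

/-! ### Coefficients of the hypergeometric series -/

section Coefficients

variable {p : ℕ} [Fact p.Prime]

theorem IsDworkTower.map {R S : Type*} [CommRing R] [CommRing S] (φ : R →+* S) {q : ℕ}
    {C d : ℕ → ℕ → R} (h : IsDworkTower q C d) :
    IsDworkTower q (fun j k => φ (C j k)) (fun j k => φ (d j k)) where
  zero j := by rw [h.zero, map_one]
  eq_mul j k := by rw [h.eq_mul, map_mul]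
  congr j := (h.congr j).map φ

theorem isDworkTower_multichoose {s : ℕ} (a : Fin s → ℤ_[p]) :
    IsDworkTower p (fun j k => ∏ i, Ring.multichoose ((dworkPrime p)^[j] (a i)) k)
      (fun j k => ∏ i, dworkFactor ((dworkPrime p)^[j] (a i)) k) where
  zero j := by simp
  eq_mul j k := by
    rw [← Finset.prod_mul_distrib]
    refine Finset.prod_congr rfl fun i _ => ?_
    rw [Function.iterate_succ_apply', ← multichoose_eq_dworkFactor_mul]
  congr j := PreservesCongr.prod _ fun i _ => preservesCongr_dworkFactor _

theorem coeff_hypF {s : ℕ} (a : Fin s → ℤ_[p]) (n : ℕ) :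
    coeff n (hypF p a) = padicIntToK p (∏ i, Ring.multichoose (a i) n) := by
  rw [hypF, coeff_mk, map_prod]
  refine Finset.prod_congr rfl fun i _ => ?_
  have h0 : (n.factorial : K p) ≠ 0 := Nat.cast_ne_zero.mpr (Nat.factorial_ne_zero n)
  rw [div_eq_iff h0, ascPochhammer_eval_eq_prod, ← map_natCast (padicIntToK p) n.factorial,
    ← map_mul, mul_comm, factorial_mul_multichoose, map_prod]
  simp

theorem frobenius_padicIntToK (x : ℤ_[p]) :
    WittVector.FractionRing.frobenius p (AlgebraicClosure (ZMod p)) (padicIntToK p x) =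
      padicIntToK p x := by
  have h : WittVector.frobenius (padicIntToW p x) = padicIntToW p x := by
    simp only [padicIntToW, RingHom.comp_apply]
    ext n
    rw [WittVector.coeff_frobenius_charP, WittVector.map_coeff, ← map_pow, ZMod.pow_card]
  have h' : WittVector.FractionRing.frobenius p (AlgebraicClosure (ZMod p))
      (algebraMap (W p) (K p) (padicIntToW p x)) =
        algebraMap (W p) (K p) (WittVector.frobenius (padicIntToW p x)) :=
    IsFractionRing.ringEquivOfRingEquiv_algebraMap _ _
  rw [h] at h'
  exact h'

theorem coeff_sigma_hypF_mul {s : ℕ} (a : Fin s → ℤ_[p]) (c : W p) (m : ℕ) :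
    coeff (p * m) (sigma p c (hypF p a)) =
      padicIntToK p (∏ i, Ring.multichoose (a i) m) * algebraMap (W p) (K p) c ^ m := by
  rw [sigma, coeff_mk, if_pos (dvd_mul_right _ _),
    Nat.mul_div_cancel_left _ (Fact.out : p.Prime).pos, coeff_hypF, frobenius_padicIntToK]

theorem coeff_sigma_of_not_dvd (c : W p) (f : (K p)⟦X⟧) {k : ℕ} (h : ¬ p ∣ k) :
    coeff k (sigma p c f) = 0 := by
  rw [sigma, coeff_mk, if_neg h]

theorem dvd_inverse_sub_inverse {R : Type*} [CommRing R] {x y n : R} (hx : IsUnit x)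
    (hy : IsUnit y) (h : n ∣ x - y) : n ∣ Ring.inverse x - Ring.inverse y := by
  have e : Ring.inverse x - Ring.inverse y = (y - x) * (Ring.inverse x * Ring.inverse y) := by
    linear_combination Ring.inverse y * Ring.mul_inverse_cancel x hx -
      Ring.inverse x * Ring.mul_inverse_cancel y hy
  rw [e]
  exact (dvd_sub_comm.mp h).mul_right _

/-- Dividing the index by `p` loses one power, which the gain in `D`, and that in `Γ` together with
`p ^ r`, restores. -/
theorem preservesCongr_logQuotient {R : Type*} [CommRing R] {p : ℕ} (hp : p.Prime)
    {u D Γ : ℕ → R} {r δ : ℕ} (hunit : ∀ k, IsUnit (u k)) (huc : PreservesCongr p u)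
    (hD : ∀ e m m' : ℕ, m ≡ m' [MOD p ^ e] → (p : R) ^ (e + 1) ∣ D m - D m')
    (hΓ : ∀ e m m' : ℕ, m ≡ m' [MOD p ^ e] → (p : R) ^ (e + δ) ∣ Γ m - Γ m')
    (hcast : ∀ k : ℕ, ¬ p ∣ k → IsUnit (k : R)) (hrδ : 1 ≤ r + δ) :
    PreservesCongr p fun k => (p : R) ^ r *
      if p ∣ k then Ring.inverse (u k) * (D (k / p) - Γ (k / p)) else Ring.inverse (k : R) := by
  intro e k k' hk
  rcases e with _ | e
  · simp
  have hdvd : p ∣ k ↔ p ∣ k' := (hk.of_dvd (dvd_pow_self p e.succ_ne_zero)).dvd_iff dvd_rfl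
  dsimp only
  by_cases h : p ∣ k
  · rw [if_pos h, if_pos (hdvd.mp h)]
    obtain ⟨m, rfl⟩ := h
    obtain ⟨m', rfl⟩ := hdvd.mp (dvd_mul_right _ _)
    rw [Nat.mul_div_cancel_left _ hp.pos, Nat.mul_div_cancel_left _ hp.pos]
    have hm : m ≡ m' [MOD p ^ e] := by
      rw [pow_succ'] at hk
      exact Nat.ModEq.mul_left_cancel' hp.ne_zero hk
    have h1 := dvd_inverse_sub_inverse (hunit _) (hunit _) (huc _ _ _ hk)
    have h2 := hD e m m' hm
    have h3 : (p : R) ^ (e + 1) ∣ p ^ r * (Γ m - Γ m') :=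
      (pow_dvd_pow _ (by omega)).trans
        (pow_add (p : R) r (e + δ) ▸ mul_dvd_mul_left _ (hΓ e m m' hm))
    have e1 : (p : R) ^ r * (Ring.inverse (u (p * m)) * (D m - Γ m)) -
        p ^ r * (Ring.inverse (u (p * m')) * (D m' - Γ m')) =
        (Ring.inverse (u (p * m)) - Ring.inverse (u (p * m'))) * (p ^ r * (D m - Γ m)) +
          ((D m - D m') * (p ^ r * Ring.inverse (u (p * m'))) -
            p ^ r * (Γ m - Γ m') * Ring.inverse (u (p * m'))) := by ring
    rw [e1]
    exact dvd_add (h1.mul_right _) (dvd_sub (h2.mul_right _) (h3.mul_right _))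
  · rw [if_neg h, if_neg (hdvd.not.mp h), ← mul_sub]
    exact (dvd_inverse_sub_inverse (hcast _ h) (hcast _ (hdvd.not.mp h))
      (pow_dvd_natCast_sub_of_modEq hk)).mul_left _

/-- The quotients of the coefficients of `G_a(t)` by those of `F_a(t)` are integral, and compatible
with congruences up to the precision of the logarithm of `c`. -/
theorem exists_coeff_hypG_eq {s : ℕ} (a : Fin s → ℤ_[p]) (ε : W p) {r δ : ℕ} (hrδ : 1 ≤ r + δ)
    (hδ : ∀ k, k ≠ 0 → (p : W p) ^ δ * ((k + 1).factorial : W p) ∣ p ^ k * ε ^ (k + 1)) :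
    ∃ q : ℕ → W p, PreservesCongr p (fun k => (p : W p) ^ r * q k) ∧
      ∀ k, coeff k (hypG p a (1 + p * ε)) = algebraMap (W p) (K p)
        (padicIntToW p (∏ i, Ring.multichoose (a i) k) * q k) := by
  have hp := (Fact.out : p.Prime)
  have hpK : (p : K p) ≠ 0 := Nat.cast_ne_zero.mpr hp.ne_zero
  choose P hP hψ using fun i => exists_isLogQuotient_psiTilde (a i)
  obtain ⟨D', hD', hD0⟩ := IsLogQuotient.exists_prod Finset.univ (fun i _ => hP i)
  have hD := hD'.map (padicIntToW p)
  set D : ℕ → W p := fun m => padicIntToW p (D' m) with hDdef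
  obtain ⟨Γ, hΓ, hΓc, hlog⟩ := exists_logQuotient_one_add ε
  set u : ℕ → W p := fun k => padicIntToW p (∏ i, unitRatio (a i) k) with hu
  have hunit : ∀ k, IsUnit (u k) := fun k => by
    refine IsUnit.map _ ?_
    rw [IsUnit.prod_iff]
    exact fun i _ => isUnit_unitRatio _ _
  have huc : PreservesCongr p u :=
    (PreservesCongr.prod _ fun i _ => preservesCongr_unitRatio (a i)).map _
  have hA : ∀ m, padicIntToW p (∏ i, Ring.multichoose (a i) (p * m)) =
      u (p * m) * padicIntToW p (∏ i, Ring.multichoose (dworkPrime p (a i)) m) := fun m => by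
    rw [← map_mul, ← Finset.prod_mul_distrib]
    congr 1
    refine Finset.prod_congr rfl fun i _ => ?_
    rw [multichoose_eq_dworkFactor_mul, dworkFactor_mul_left, Nat.mul_div_cancel_left _ hp.pos]
  refine ⟨fun k => if p ∣ k then Ring.inverse (u k) * (D (k / p) - Γ (k / p))
    else Ring.inverse (k : W p), ?_, fun k => ?_⟩
  · exact preservesCongr_logQuotient hp hunit huc hD.congr (hΓc δ hδ) (fun _ => isUnit_natCast_W)
      hrδ
  · dsimp only
    rw [hypG, map_add, coeff_C, intLog, coeff_mk]
    rcases eq_or_ne k 0 with rfl | hk0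
    -- Constant term: `γ_p` cancels in `∑ ψ_p(a_i) + s γ_p`, leaving `D 0`, and `p⁻¹ log c` is `Γ
    -- 0`.
    · have hu0 : u 0 = 1 := by simp [hu, unitRatio, pochUnits]
      have hA0 : ∏ i, Ring.multichoose (a i) 0 = 1 := by simp
      rw [if_pos rfl, if_pos rfl, if_pos (dvd_zero _), hu0, hA0, Nat.zero_div, Ring.inverse_one,
        map_one, one_mul, one_mul, add_zero, hlog, map_mul, map_natCast, inv_mul_cancel_left₀ hpK,
        map_sub, hDdef]
      congr 1
      simp only [hD0, map_sum, digamma, Finset.sum_add_distrib, Finset.sum_const, Finset.card_univ,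
        Fintype.card_fin, nsmul_eq_mul, hψ]
      rw [mul_neg, add_comm, add_neg_cancel_left]
      rfl
    · have hkK : (k : K p) ≠ 0 := Nat.cast_ne_zero.mpr hk0
      rw [if_neg hk0, if_neg hk0, zero_add, map_sub, coeff_hypF, div_eq_iff hkK]
      by_cases h : p ∣ k
      · rw [if_pos h]
        obtain ⟨m, rfl⟩ := h
        rw [coeff_sigma_hypF_mul, Nat.mul_div_cancel_left _ hp.pos]
        have hinv := Ring.mul_inverse_cancel _ (hunit (p * m))
        have hAm := hA m
        have hDm : u (p * m) = 1 + p * m * D m := hD.eq m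
        have hΓm := hΓ m
        set A := padicIntToW p (∏ i, Ring.multichoose (a i) (p * m))
        set A' := padicIntToW p (∏ i, Ring.multichoose (dworkPrime p (a i)) m)
        change algebraMap (W p) (K p) A - algebraMap (W p) (K p) A' *
          algebraMap (W p) (K p) (1 + p * ε) ^ m = _
        -- With `A = u A'`, the two leading `1`s in `u - c ^ m` cancel, leaving the factor `p m`
        -- that the integration divides out.
        have key : A - A' * (1 + p * ε) ^ m =
            A * (Ring.inverse (u (p * m)) * (D m - Γ m)) * ((p * m : ℕ) : W p) := by
          rw [hAm, hΓm, Nat.cast_mul]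
          linear_combination A' * hDm - A' * p * m * (D m - Γ m) * hinv
        have := congrArg (algebraMap (W p) (K p)) key
        rw [map_sub, map_mul, map_pow, map_mul _ _ ((p * m : ℕ) : W p), map_natCast] at this
        exact this
      · rw [if_neg h, coeff_sigma_of_not_dvd _ _ h, sub_zero,
          ← map_natCast (algebraMap (W p) (K p)) k, ← map_mul, mul_assoc,
          Ring.inverse_mul_cancel _ (isUnit_natCast_W h), mul_one]
        rfl

/-! ### Truncations and quotients of integral series. -/

theorem truncLT_map (m : ℕ) (u : ℕ → W p) :
    truncLT p m (PowerSeries.map (algebraMap (W p) (K p)) (mk u)) =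
      PowerSeries.map (algebraMap (W p) (K p)) (mk (cutoff m u)) := by
  ext k
  rw [truncLT, Polynomial.coeff_coe, coeff_trunc, coeff_map, coeff_map, coeff_mk, coeff_mk, cutoff]
  split_ifs <;> simp

theorem map_eq_inv_of_mul_eq_one {f F : (W p)⟦X⟧} (h : f * F = 1) :
    PowerSeries.map (algebraMap (W p) (K p)) F =
      (PowerSeries.map (algebraMap (W p) (K p)) f)⁻¹ := by
  have h1 : PowerSeries.map (algebraMap (W p) (K p)) F *
      PowerSeries.map (algebraMap (W p) (K p)) f = 1 := by
    rw [← map_mul, mul_comm, h, map_one]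
  refine (PowerSeries.eq_inv_iff_mul_eq_one ?_).mpr h1
  intro h0
  have := congrArg constantCoeff h1
  rw [map_mul, h0, mul_zero, map_one] at this
  exact zero_ne_one this

theorem congrMod_of_dvd {n : ℕ} {f f' g g' : (W p)⟦X⟧} (hf : IsUnit f) (hf' : IsUnit f')
    (h : (p : (W p)⟦X⟧) ^ n ∣ g * f' - g' * f) :
    CongrMod p n
      (PowerSeries.map (algebraMap (W p) (K p)) g * (PowerSeries.map (algebraMap (W p) (K p)) f)⁻¹)
      (PowerSeries.map (algebraMap (W p) (K p)) g' *
        (PowerSeries.map (algebraMap (W p) (K p)) f')⁻¹) := by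
  obtain ⟨F, hF⟩ := hf.exists_right_inv
  obtain ⟨F', hF'⟩ := hf'.exists_right_inv
  obtain ⟨w, hw⟩ := h
  refine ⟨g * F, g' * F', ?_, ?_, w * F * F', ?_⟩
  · rw [map_mul, map_eq_inv_of_mul_eq_one hF]
  · rw [map_mul, map_eq_inv_of_mul_eq_one hF']
  · linear_combination F * F' * hw - g * F * hF' + g' * F' * hF

theorem isUnit_mk_of_zero {R : Type*} [CommRing R] {u : ℕ → R} (h : u 0 = 1) :
    IsUnit (mk u) := by
  rw [PowerSeries.isUnit_iff_constantCoeff, ← coeff_zero_eq_constantCoeff_apply, coeff_mk, h]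
  exact isUnit_one

/-- The congruence between `G_a / F_a` and the quotient of the truncations. -/
theorem congrMod_hypLog {s : ℕ} (a : Fin s → ℤ_[p]) (ε : W p) {r δ n : ℕ} (hrδ : 1 ≤ r + δ)
    (hrn : r ≤ n)
    (hδ : ∀ k, k ≠ 0 → (p : W p) ^ δ * ((k + 1).factorial : W p) ∣ p ^ k * ε ^ (k + 1)) :
    CongrMod p (n - r) (hypLog p a (1 + p * ε))
      (truncLT p (p ^ n) (hypG p a (1 + p * ε)) * (truncLT p (p ^ n) (hypF p a))⁻¹) := by
  have hp := (Fact.out : p.Prime)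
  obtain ⟨q, hq, hG⟩ := exists_coeff_hypG_eq a ε hrδ hδ
  set A : ℕ → W p := fun k => padicIntToW p (∏ i, Ring.multichoose (a i) k) with hA
  have hF' : hypF p a = PowerSeries.map (algebraMap (W p) (K p)) (mk A) := by
    ext k
    rw [coeff_hypF, coeff_map, coeff_mk]
    rfl
  have hG' : hypG p a (1 + p * ε) =
      PowerSeries.map (algebraMap (W p) (K p)) (mk fun k => A k * q k) := by
    ext k
    rw [hG, coeff_map, coeff_mk]
  have hA0 : A 0 = 1 := by simp [hA]
  rw [hypLog, hF', hG', truncLT_map, truncLT_map]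
  refine congrMod_of_dvd (isUnit_mk_of_zero hA0) (isUnit_mk_of_zero ?_) ?_
  · rw [cutoff, if_pos (pow_pos hp.pos n), hA0]
  -- Dwork's congruence applies to `p ^ r q`; dividing by `p ^ r` then lowers the modulus to `p ^ (n
  -- - r)`.
  · have h := dvd_mul_cutoff_sub_of_isDworkTower hp.ne_zero
      ((isDworkTower_multichoose a).map (padicIntToW p)) n 0 _ hq
    simp only [Function.iterate_zero, id_eq] at h
    have e1 : (mk fun k => A k * ((p : W p) ^ r * q k)) =
        (p : (W p)⟦X⟧) ^ r * mk fun k => A k * q k := by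
      refine PowerSeries.ext fun k => ?_
      have hC : (p : (W p)⟦X⟧) ^ r = C ((p : W p) ^ r) := by simp
      rw [hC, coeff_C_mul, coeff_mk, coeff_mk]
      exact mul_left_comm _ _ _
    have e2 : mk (cutoff (p ^ n) fun k => A k * ((p : W p) ^ r * q k)) =
        (p : (W p)⟦X⟧) ^ r * mk (cutoff (p ^ n) fun k => A k * q k) := by
      refine PowerSeries.ext fun k => ?_
      have hC : (p : (W p)⟦X⟧) ^ r = C ((p : W p) ^ r) := by simp
      rw [hC, coeff_C_mul, coeff_mk, coeff_mk]
      simp only [cutoff]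
      split_ifs
      · exact mul_left_comm _ _ _
      · simp
    rw [e1, e2, mul_assoc, mul_assoc, ← mul_sub] at h
    have hpr : (p : (W p)⟦X⟧) ^ r ≠ 0 := by
      refine pow_ne_zero _ fun h0 => W_p_ne_zero (p := p) ?_
      have := congrArg constantCoeff h0
      simpa using this
    rw [← Nat.add_sub_cancel' hrn, pow_add, Nat.add_sub_cancel' hrn] at h
    exact (mul_dvd_mul_iff_left hpr).mp h

end Coefficients

end PadicHG
end

theorem theorem3p2 (p : ℕ) [Fact p.Prime] (s : ℕ) (hs : 1 ≤ s) (a : Fin s → ℤ_[p])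
    (ha : ∀ (i : Fin s) (m : ℕ), a i ≠ -(m : ℤ_[p])) (c : PadicHG.W p) :
    ((∃ e : PadicHG.W p, c = 1 + 2 * (p : PadicHG.W p) * e) →
      ∀ n : ℕ, 1 ≤ n →
        PadicHG.CongrMod p n (PadicHG.hypLog p a c)
          (PadicHG.truncLT p (p ^ n) (PadicHG.hypG p a c) *
            (PadicHG.truncLT p (p ^ n) (PadicHG.hypF p a))⁻¹)) ∧
    (p = 2 → (∃ e : PadicHG.W p, c = 1 + 2 * e) →
      ∀ n : ℕ, 1 ≤ n →
        PadicHG.CongrMod p (n - 1) (PadicHG.hypLog p a c)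
          (PadicHG.truncLT p (p ^ n) (PadicHG.hypG p a c) *
            (PadicHG.truncLT p (p ^ n) (PadicHG.hypF p a))⁻¹)) := by
  constructor
  · rintro ⟨e, rfl⟩ n -
    have hc : 1 + 2 * (p : PadicHG.W p) * e = 1 + p * (2 * e) := by ring
    rw [hc]
    -- Here `δ = 1`, so no power of `p` is lost.
    exact PadicHG.congrMod_hypLog (r := 0) a (2 * e) le_rfl (Nat.zero_le n)
      fun k hk => PadicHG.pow_one_mul_factorial_dvd e hk
  · rintro hp2 ⟨e, rfl⟩ n hn
    have hc : (1 : PadicHG.W p) + 2 * e = 1 + p * e := by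
      have := congrArg (Nat.cast : ℕ → PadicHG.W p) hp2
      rw [Nat.cast_ofNat] at this
      rw [this]
    rw [hc]
    -- Here `1 ≤ r + δ` requires the loss `r = 1`.
    exact PadicHG.congrMod_hypLog (δ := 0) a e le_rfl hn
      fun k _ => PadicHG.pow_zero_mul_factorial_dvd e k
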